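/- For $n\ge 0$ and $0\le k\le n$ let layer $k$ consist of nodes $v_{k,1},\dots,v_{k,2^{n-k+1}-1}$, where layer $0$ is the input layer and layer $n$ is the single output node $v_{n,1}$. For $k\ge 1$ the children of $v_{k,i}$ are $v_{k-1,2i-1},v_{k-1,2i},v_{k-1,2i+1}$. Given filters $\theta_1,\dots,\theta_n\in\mathbb R^3$, the stride-2 convolutional iterated 3-majority network is the Boolean function $f_n:\{-1,1\}^{2^{n+1}-1}\to\{-1,1\}$ obtained by setting $f(v_{0,j})=\omega(j)$, $$f(v_{k,i})=\operatorname{sign}\Big(\sum_{j=1}^{3}\theta_k(j)\,f(v_{k-1,2i-2+j})\Big),\qquad 1\le k\le n,$$ and $f_n(\omega)=f(v_{n,1})$. Let $\omega$ be uniform on $\{-1,1\}^{2^{n+1}-1}$ and let $\omega^\epsilon$ be obtained from $\omega$ by flipping each bit independently with probability $\epsilon$. For every $n$ let $\theta_{n,1},\dots,\theta_{n,n}$ be independent random vectors in $\mathbb R^3$ (not necessarily identically distributed), independent of $(\omega,\omega^\epsilon)$, such that almost surely $\sum_{j}\theta_{n,t}(j)x_j\ne 0$ for all $x\in\{-1,1\}^3$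 (so that each filter expresses $\pm$ the 3-majority or $\pm$ a dictator). Assume that there is $p>0$ such that for all $n$ and all $1\le t\le n$, with probability at least $p$ the filter $\theta_{n,t}$ expresses a majority, i.e. $x\mapsto\operatorname{sign}(\sum_j\theta_{n,t}(j)x_j)$ is the 3-majority function on $\{-1,1\}^3$ or its negative. Let $\pi_n$ be the law of the random Boolean function $f_n$ with filters $\theta_{n,1},\dots,\theta_{n,n}$. Then $\{\pi_n\}$ is * quenched noise sensitive: for every $0<\epsilon\le 1/2$ and every $\delta>0$ there is $N$ such that for all $n\ge N$, $$\pi_n\{f:\operatorname{Cov}_{\omega,\omega^\epsilon}(f(\omega),f(\omega^\epsilon))\le\delta\}\ge 1-\delta;$$ * annealed noise sensitive: for every $0<\epsilon\le 1/2$, $$\lim_{n\to\infty}\operatorname{Cov}_{f_n,\omega,\omega^\epsilon}(f_n(\omega),f_n(\omega^\epsilon))=0,\qquad f_n\sim\pi_n .$$ -/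

import Mathlib

open MeasureTheory ProbabilityTheory Filter Topology

namespace NoiseNet

noncomputable section

/-! ### Boolean functions and noise -/

/-- Bit strings indexed by `ι`; a bit is an element of `ℤˣ = {1, -1}`. -/
abbrev Bits (ι : Type*) : Type _ := ι → ℤˣ

/-- Boolean functions `{-1, 1}^ι → {-1, 1}`. -/
abbrev BoolFun (ι : Type*) : Type _ := Bits ι → ℤˣ

/-- A bit as a real number. -/
def bitVal (b : ℤˣ) : ℝ := ((b : ℤ) : ℝ)

/-- The law of a random sign that is `-1` with probability `ε` and `1` with probability `1 - ε`. -/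
def coin (ε : ℝ) : Measure ℤˣ :=
  ENNReal.ofReal (1 - ε) • Measure.dirac 1 + ENNReal.ofReal ε • Measure.dirac (-1)

/-- The uniform distribution of the input `ω`: i.i.d. bits, each `±1` with probability `1/2`. -/
def uniformBits (ι : Type*) [Fintype ι] : Measure (Bits ι) :=
  Measure.pi fun _ => coin (1 / 2)

/-- The joint law of `(ω, ω^ε)`: `ω` is uniform and `ω^ε` is obtained from `ω` by flipping each bit
independently with probability `ε`. -/
def noisyPair (ι : Type*) [Fintype ι] (ε : ℝ) : Measure (Bits ι × Bits ι) :=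
  ((uniformBits ι).prod (Measure.pi fun _ => coin ε)).map fun q => (q.1, fun i => q.1 i * q.2 i)

/-- `Cov_{ω, ω^ε}(f(ω), f(ω^ε))` for a fixed Boolean function `f`. -/
def noiseCov {ι : Type*} [Fintype ι] (f : BoolFun ι) (ε : ℝ) : ℝ :=
  cov[fun q => bitVal (f q.1), fun q => bitVal (f q.2); noisyPair ι ε]

/-- `Cov_{f, ω, ω^ε}(f(ω), f(ω^ε))` where `f` has law `π` and is independent of `(ω, ω^ε)`. -/
def annealedNoiseCov {ι : Type*} [Fintype ι] (π : Measure (BoolFun ι)) (ε : ℝ) : ℝ :=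
  cov[fun q => bitVal (q.1 q.2.1), fun q => bitVal (q.1 q.2.2); π.prod (noisyPair ι ε)]

/-- Quenched noise sensitivity of a sequence `π n` of laws of random Boolean functions. -/
def QuenchedNoiseSensitive {ι : ℕ → Type*} [∀ n, Fintype (ι n)]
    (π : ∀ n, Measure (BoolFun (ι n))) : Prop :=
  ∀ ε : ℝ, 0 < ε → ε ≤ 1 / 2 → ∀ δ : ℝ, 0 < δ →
    ∃ N : ℕ, ∀ n ≥ N, 1 - δ ≤ (π n).real {f | noiseCov f ε ≤ δ}

/-- Annealed noise sensitivity of a sequence `π n` of laws of random Boolean functions. -/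
def AnnealedNoiseSensitive {ι : ℕ → Type*} [∀ n, Fintype (ι n)]
    (π : ∀ n, Measure (BoolFun (ι n))) : Prop :=
  ∀ ε : ℝ, 0 < ε → ε ≤ 1 / 2 → Tendsto (fun n => annealedNoiseCov (π n) ε) atTop (𝓝 0)

/-! ### The stride-2 convolutional network -/

/-- The sign activation. The value at `0` is a convention; it plays no role for filters without
ties. -/
def sgn (x : ℝ) : ℤˣ := if 0 ≤ x then 1 else -1

/-- The pre-activation `θ₀ x₀ + θ₁ x₁ + θ₂ x₂` of a filter with weights `θ`. -/
def preact (θ : Fin 3 → ℝ) (x : Bits (Fin 3)) : ℝ := ∑ i, θ i * bitVal (x i)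

/-- The weighted 3-majority with weights `θ`. -/
def weightedMaj (θ : Fin 3 → ℝ) : BoolFun (Fin 3) := fun x => sgn (preact θ x)

/-- The regular 3-majority, i.e. the weighted 3-majority with weights `(1, 1, 1)`. -/
def maj3 : BoolFun (Fin 3) := weightedMaj fun _ => 1

/-- The filter `θ` has no ties: its pre-activation never vanishes. -/
def NoTies (θ : Fin 3 → ℝ) : Prop := ∀ x : Bits (Fin 3), preact θ x ≠ 0

/-- The filter `θ` expresses a majority: the regular 3-majority or its negative. -/
def ExpressesMajority (θ : Fin 3 → ℝ) : Prop :=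
  (∀ x, weightedMaj θ x = maj3 x) ∨ (∀ x, weightedMaj θ x = -maj3 x)

/-- The positions in a layer with `m` layers above it: there are `2^(m+1) - 1` of them. -/
abbrev Layer (m : ℕ) : Type := Fin (2 ^ (m + 1) - 1)

/-- Child `j ∈ {0, 1, 2}` of node `i` in the next layer below: it has position `2 i + j`, counting
from `0` (that is, the children of node `i` are `2 i - 1`, `2 i`, `2 i + 1`, counting from `1`). -/
def child {m : ℕ} (i : Layer m) (j : Fin 3) : Layer (m + 1) :=
  ⟨2 * i.1 + j.1, by
    have hi := i.2
    have hj := j.2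
    have h : 2 ^ (m + 1 + 1) = 2 * 2 ^ (m + 1) := by ring
    omega⟩

/-- One convolutional layer with filter size 3 and stride 2 and no padding: the same filter `θ` is
applied to all triples of children. -/
def convLayer {m : ℕ} (θ : Fin 3 → ℝ) (x : Bits (Layer (m + 1))) : Bits (Layer m) :=
  fun i => weightedMaj θ fun j => x (child i j)

/-- The Boolean function of the stride-2 network of depth `n`. The filter `θ 0` is applied to the
input layer, then `θ 1`, and so on; `θ (n - 1)` yields the single output node. -/
def network : (n : ℕ) → (Fin n → Fin 3 → ℝ) → BoolFun (Layer n)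
  | 0, _ => fun ω => ω ⟨0, by norm_num⟩
  | n + 1, θ => fun ω => network n (Fin.tail θ) (convLayer (θ 0) ω)

/-- The law of the random Boolean function given by the network of depth `n` with random filters
`θ 0, …, θ (n - 1)`. -/
def networkLaw {Ω : Type*} [MeasurableSpace Ω] (P : Measure Ω) (n : ℕ)
    (θ : Fin n → Ω → Fin 3 → ℝ) : Measure (BoolFun (Layer n)) :=
  P.map fun w => network n fun t => θ t w

end

end NoiseNet

/-!
If a randomized query algorithm evaluates `f` and reads each input bit with probability at most `δ`,
then by the Schramm–Steif inequality `f` has Walsh weight at most `d * δ` on level `d`, so its noise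
covariance is at most `δ / (2 * ε) ^ 2`. It remains to find, for typical filters, such algorithms
with small `δ`.

The algorithm works its way down from the output node, four layers at a time. Cut the inputs into
blocks of size `2 ^ k`; a node of row `k` depends on two adjacent blocks, and a block is touched if
a node depending on it is read. A block can only be touched if the larger block containing it, four
rows up, is touched, so the probability of touching a given block never grows on the way down. It
shrinks by a constant factor across four layers of majorities: there the algorithm defers the nodes
of one random block in each group of `32` and reads them only if they matter. Majorities are odd, so
flipping the signs of inputs in the larger block leads from any input to one for which the deferred
nodes do not matter, and the larger block is untouched as often as before.

Each group of four layers consists of majorities with probability at least `p ^ 4`, independently of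
the others, so the expected noise covariance decays geometrically with the depth.
-/

namespace NoiseNet

noncomputable section

open Finset
open scoped BigOperators

section UniformProb

variable {α β : Type*} [Fintype α] [Fintype β] {p q : α → Prop}

open Classical in
/-- The probability of an event under the uniform distribution on a finite type, as a real number;
it is `0` on an empty type. -/
def uniformProb (p : α → Prop) : ℝ := 𝔼 x, if p x then 1 else 0

theorem uniformProb_mono (h : ∀ x, p x → q x) : uniformProb p ≤ uniformProb q :=
  expect_le_expect fun x _ => by
    by_cases hp : p x
    · simp [hp, h x hp]
    · simp only [hp, if_false]
      split_ifs <;> norm_num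

theorem uniformProb_le_one [Nonempty α] (p : α → Prop) : uniformProb p ≤ 1 :=
  expect_le univ_nonempty fun x _ => by split_ifs <;> norm_num

theorem uniformProb_comp_equiv (e : α ≃ β) (p : β → Prop) :
    uniformProb (fun x => p (e x)) = uniformProb p :=
  Fintype.expect_equiv e _ _ fun _ => rfl

theorem uniformProb_prod (p : α × β → Prop) :
    uniformProb p = 𝔼 x, uniformProb fun y => p (x, y) := by
  rw [uniformProb, ← univ_product_univ, expect_product]
  rfl

theorem uniformProb_snd [Nonempty α] (p : β → Prop) :
    uniformProb (fun q : α × β => p q.2) = uniformProb p :=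
  (uniformProb_prod _).trans (expect_const univ_nonempty (uniformProb p))

theorem uniformProb_exists_le_sum {ι : Type*} (S : Finset ι) (p : ι → α → Prop) :
    uniformProb (fun x => ∃ i ∈ S, p i x) ≤ ∑ i ∈ S, uniformProb (p i) := by
  classical
  simp only [uniformProb]
  rw [← expect_sum_comm]
  refine expect_le_expect fun x _ => ?_
  have hnonneg : ∀ i ∈ S, (0 : ℝ) ≤ if p i x then 1 else 0 := fun i _ => by
    split_ifs <;> norm_num
  split_ifs with h
  · obtain ⟨i, hi, hp⟩ := h
    simpa [hp] using single_le_sum hnonneg hi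
  · exact sum_nonneg hnonneg

/-- Averaging over `s` replaces `B` by `B ∘ φ s`, and for each `x` at least one of these events
fails. -/
theorem uniformProb_le_of_exists_equiv {S : Type*} [Fintype S] [Nonempty S] (φ : S → α ≃ α)
    {B E : α → Prop} (hBE : ∀ x, B x → E x) (hE : ∀ s x, E (φ s x) → E x)
    (hB : ∀ x, ∃ s, ¬ B (φ s x)) :
    uniformProb B ≤ (1 - 1 / (Fintype.card S : ℝ)) * uniformProb E := by
  classical
  have hcount : ∀ x, ∑ s, (if B (φ s x) then (1 : ℝ) else 0) ≤
      ((Fintype.card S : ℝ) - 1) * if E x then 1 else 0 := by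
    intro x
    obtain ⟨s₀, hs₀⟩ := hB x
    rw [← add_sum_erase _ _ (mem_univ s₀), if_neg hs₀, zero_add]
    calc ∑ s ∈ univ.erase s₀, (if B (φ s x) then (1 : ℝ) else 0)
        ≤ ∑ _ ∈ univ.erase s₀, if E x then (1 : ℝ) else 0 := sum_le_sum fun s _ => by
          by_cases hs : B (φ s x)
          · simp [hs, hE s x (hBE _ hs)]
          · simp only [hs, if_false]
            split_ifs <;> norm_num
      _ = ((Fintype.card S : ℝ) - 1) * if E x then 1 else 0 := by
          rw [sum_const, card_erase_of_mem (mem_univ _), card_univ, nsmul_eq_mul,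
            Nat.cast_pred Fintype.card_pos]
  have hcard : (0 : ℝ) < Fintype.card S := by exact_mod_cast Fintype.card_pos
  have hsum : Fintype.card S * uniformProb B ≤ ((Fintype.card S : ℝ) - 1) * uniformProb E :=
    calc Fintype.card S * uniformProb B
        = ∑ s, uniformProb fun x => B (φ s x) := by simp [uniformProb_comp_equiv]
      _ = 𝔼 x, ∑ s, if B (φ s x) then (1 : ℝ) else 0 := by
          simp only [uniformProb]
          exact (expect_sum_comm _ _ _).symm
      _ ≤ 𝔼 x, ((Fintype.card S : ℝ) - 1) * if E x then 1 else 0 :=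
          expect_le_expect fun x _ => hcount x
      _ = ((Fintype.card S : ℝ) - 1) * uniformProb E := by rw [← mul_expect, uniformProb]
  refine le_of_mul_le_mul_left (hsum.trans_eq ?_) hcard
  field_simp

end UniformProb

section Decides

variable {ι κ α β γ : Type*}

/-- A query rule assigns to every input `x` the set `Q x` of coordinates it reads. It decides `F` if
the coordinates it reads determine the value of `F`. A rule that can be carried out adaptively
decides itself: what it has read determines which coordinates those are. -/
def Decides (Q : (ι → α) → Set ι) (F : (ι → α) → β) : Prop :=
  ∀ ⦃x y⦄, Set.EqOn x y (Q x) → F x = F y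

/-- To read the coordinates `Q (Φ y)` of `Φ y`, read for each of them the set given by the rule `A`
for that coordinate. -/
def refineRule (Φ : (ι → α) → κ → β) (A : (ι → α) → κ → Set ι) (Q : (κ → β) → Set κ) :
    (ι → α) → Set ι :=
  fun y => ⋃ J ∈ Q (Φ y), A y J

variable {Φ : (ι → α) → κ → β} {A : (ι → α) → κ → Set ι} {Q : (κ → β) → Set κ}

theorem Decides.refine {F : (κ → β) → γ} (hQ : Decides Q F)
    (hΦ : ∀ J, Decides (fun y => A y J) fun y => Φ y J) :
    Decides (refineRule Φ A Q) fun y => F (Φ y) :=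
  fun _ _ h => hQ fun J hJ => hΦ J (h.mono (Set.subset_biUnion_of_mem hJ))

theorem Decides.refine_self (hQ : Decides Q Q)
    (hΦ : ∀ J, Decides (fun y => A y J) fun y => Φ y J)
    (hA : ∀ J, Decides (fun y => A y J) fun y => A y J) :
    Decides (refineRule Φ A Q) (refineRule Φ A Q) := fun x y h => by
  have hread : Q (Φ x) = Q (Φ y) := hQ.refine hΦ h
  simp only [refineRule, ← hread]
  exact Set.iUnion₂_congr fun J hJ => hA J (h.mono (Set.subset_biUnion_of_mem hJ))

open Classical in
/-- The rule for `F` that reads the set `s` first, and reads the larger set `u` only if `s` leaves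
the value of `F` open. -/
def lazyQuery (F : (ι → α) → β) (s u : Set ι) (y : ι → α) : Set ι :=
  if ∀ y', Set.EqOn y y' s → F y = F y' then s else u

variable {F : (ι → α) → β} {s u : Set ι}

theorem lazyQuery_subset (hsu : s ⊆ u) (y : ι → α) : lazyQuery F s u y ⊆ u := by
  unfold lazyQuery
  split_ifs
  exacts [hsu, subset_rfl]

theorem subset_lazyQuery (hsu : s ⊆ u) (y : ι → α) : s ⊆ lazyQuery F s u y := by
  unfold lazyQuery
  split_ifs
  exacts [subset_rfl, hsu]

theorem decides_lazyQuery (hF : DependsOn F u) : Decides (lazyQuery F s u) F := by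
  intro x y h
  unfold lazyQuery at h
  split_ifs at h with hs
  · exact hs y h
  · exact hF h

theorem decides_lazyQuery_self (hsu : s ⊆ u) :
    Decides (lazyQuery F s u) (lazyQuery F s u) := by
  classical
  intro x y h
  have hxy : Set.EqOn x y s := h.mono (subset_lazyQuery hsu x)
  have hiff : (∀ z, Set.EqOn x z s → F x = F z) ↔ ∀ z, Set.EqOn y z s → F y = F z :=
    ⟨fun hx z hz => (hx y hxy).symm.trans (hx z (hxy.trans hz)),
      fun hy z hz => (hy x hxy.symm).symm.trans (hy z (hxy.symm.trans hz))⟩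
  unfold lazyQuery
  exact if_congr hiff rfl rfl

end Decides

section Walsh

theorem bitVal_mul (a b : ℤˣ) : bitVal (a * b) = bitVal a * bitVal b := by simp [bitVal]

theorem bitVal_neg (a : ℤˣ) : bitVal (-a) = -bitVal a := by simp [bitVal]

theorem bitVal_one : bitVal 1 = 1 := by simp [bitVal]

theorem bitVal_mul_self (a : ℤˣ) : bitVal a * bitVal a = 1 := by
  rw [← bitVal_mul, Int.units_mul_self, bitVal_one]

theorem abs_bitVal (a : ℤˣ) : |bitVal a| = 1 := by
  rcases Int.units_eq_one_or a with rfl | rfl <;> simp [bitVal]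

variable {ι : Type*}

/-- The Walsh character `∏ i ∈ S, x i` of a finite set `S` of coordinates. -/
def walsh (S : Finset ι) (x : Bits ι) : ℝ := ∏ i ∈ S, bitVal (x i)

theorem walsh_empty (x : Bits ι) : walsh ∅ x = 1 := prod_empty

theorem walsh_mul (S : Finset ι) (x z : Bits ι) :
    walsh S (fun i => x i * z i) = walsh S x * walsh S z := by
  simp only [walsh, bitVal_mul, prod_mul_distrib]

theorem walsh_mul_self (S : Finset ι) (x : Bits ι) : walsh S x * walsh S x = 1 := by
  rw [walsh, ← prod_mul_distrib]
  exact prod_eq_one fun i _ => bitVal_mul_self _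

section Flip

variable [DecidableEq ι] {i : ι} {S : Finset ι}

/-- The input `x` with bit `i` flipped. -/
def flipAt (i : ι) (x : Bits ι) : Bits ι := Function.update x i (-x i)

theorem flipAt_involutive (i : ι) : Function.Involutive (flipAt i) := fun x => by simp [flipAt]

theorem eqOn_flipAt {s : Set ι} (hi : i ∉ s) (x : Bits ι) : Set.EqOn x (flipAt i x) s :=
  fun j hj => by simp [flipAt, Function.update_of_ne (ne_of_mem_of_not_mem hj hi)]

theorem walsh_flipAt_of_mem (hi : i ∈ S) (x : Bits ι) : walsh S (flipAt i x) = -walsh S x := by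
  unfold walsh
  rw [← mul_prod_erase S _ hi, ← mul_prod_erase S (fun j => bitVal (x j)) hi, ← neg_mul]
  congr 1
  · simp [flipAt, bitVal_neg]
  · exact prod_congr rfl fun j hj => by rw [← eqOn_flipAt (notMem_erase i S) x hj]

theorem walsh_flipAt_of_notMem (hi : i ∉ S) (x : Bits ι) : walsh S (flipAt i x) = walsh S x :=
  prod_congr rfl fun j hj => by rw [← eqOn_flipAt (s := S) hi x hj]

theorem Decides.apply_flipAt {β : Type*} {Q : Bits ι → Set ι} {F : Bits ι → β} (hQ : Decides Q F)
    {x : Bits ι} (hi : i ∉ Q x) : F (flipAt i x) = F x :=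
  (hQ (eqOn_flipAt hi x)).symm

theorem Decides.mem_flipAt_iff {J : Bits ι → Set ι} (hJ : Decides J J) (x : Bits ι) :
    i ∈ J (flipAt i x) ↔ i ∈ J x := by
  refine ⟨fun h => by_contra fun hi => hi (hJ.apply_flipAt hi ▸ h),
    fun h => by_contra fun hi => hi ?_⟩
  rwa [← hJ.apply_flipAt hi, flipAt_involutive i x]

end Flip

variable [Fintype ι] [DecidableEq ι]

theorem expect_eq_zero_of_flipAt (i : ι) {G : Bits ι → ℝ}
    (hG : ∀ x, G (flipAt i x) = -G x) : 𝔼 x, G x = 0 := by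
  have h : 𝔼 x, G (flipAt i x) = 𝔼 x, G x :=
    Fintype.expect_equiv (flipAt_involutive i).toPerm _ _ fun _ => rfl
  simp only [hG, expect_neg_distrib] at h
  linarith

theorem expect_walsh_mul_walsh_eq_zero {S T : Finset ι} (h : ¬ S ⊆ T) :
    𝔼 x, walsh S x * walsh T x = 0 := by
  obtain ⟨i, hiS, hiT⟩ := not_subset.1 h
  exact expect_eq_zero_of_flipAt i fun x => by
    rw [walsh_flipAt_of_mem hiS, walsh_flipAt_of_notMem hiT, neg_mul]

theorem sum_walsh_mul_walsh (x y : Bits ι) :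
    ∑ S : Finset ι, walsh S x * walsh S y = if x = y then (Fintype.card (Bits ι) : ℝ) else 0 := by
  have hprod : ∑ S : Finset ι, walsh S x * walsh S y = ∏ i, (1 + bitVal (x i) * bitVal (y i)) := by
    rw [prod_one_add, powerset_univ]
    exact sum_congr rfl fun S _ => by rw [walsh, walsh, prod_mul_distrib]
  rw [hprod]
  split_ifs with hxy
  · subst hxy
    simp only [bitVal_mul_self, prod_const, card_univ, Fintype.card_fun, Fintype.card_units_int,
      Nat.cast_pow]
    norm_num
  · obtain ⟨i, hi⟩ := Function.ne_iff.1 hxy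
    refine prod_eq_zero (mem_univ i) ?_
    rw [Int.units_ne_iff_eq_neg.1 hi, bitVal_neg, neg_mul, bitVal_mul_self, add_neg_cancel]

/-- The Fourier–Walsh coefficient of `f` at `S`. -/
def walshCoeff (f : Bits ι → ℝ) (S : Finset ι) : ℝ := 𝔼 x, f x * walsh S x

theorem walshCoeff_one {S : Finset ι} (hS : S ≠ ∅) : walshCoeff (fun _ => 1) S = 0 := by
  have h := expect_walsh_mul_walsh_eq_zero (S := S) (T := ∅) (by rwa [subset_empty])
  simpa only [walshCoeff, one_mul, walsh_empty, mul_one] using h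

theorem sum_walshCoeff_mul_walsh (f : Bits ι → ℝ) (x : Bits ι) :
    ∑ S : Finset ι, walshCoeff f S * walsh S x = f x := by
  calc ∑ S : Finset ι, walshCoeff f S * walsh S x
      = 𝔼 y, f y * ∑ S : Finset ι, walsh S y * walsh S x := by
        simp only [walshCoeff, expect_mul, mul_sum, mul_assoc]
        exact (expect_sum_comm _ _ _).symm
    _ = f x := by
        simp only [sum_walsh_mul_walsh, Fintype.expect_eq_sum_div_card, mul_ite, mul_zero,
          sum_ite_eq', mem_univ, if_true]
        exact mul_div_cancel_right₀ _ (Nat.cast_ne_zero.2 Fintype.card_ne_zero)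

/-- The Fourier weight of `f` at level `d`. -/
def levelWeight (f : Bits ι → ℝ) (d : ℕ) : ℝ :=
  ∑ S ∈ powersetCard d univ, walshCoeff f S ^ 2

theorem levelWeight_nonneg (f : Bits ι → ℝ) (d : ℕ) : 0 ≤ levelWeight f d :=
  sum_nonneg fun _ _ => sq_nonneg _

end Walsh

section SchrammSteif

variable {ι : Type*} {J : Bits ι → Set ι} {S T : Finset ι} {i : ι}

open Classical in
/-- The Walsh character of `S`, cut off to the inputs on which the query rule `J` reads at least
one coordinate of `S`. -/
def revealedWalsh (J : Bits ι → Set ι) (S : Finset ι) (x : Bits ι) : ℝ :=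
  if Disjoint (S : Set ι) (J x) then 0 else walsh S x

theorem revealedWalsh_flipAt [DecidableEq ι] (hJ : Decides J J) (hi : i ∉ S) {x : Bits ι}
    (hx : i ∉ J x) : revealedWalsh J S (flipAt i x) = revealedWalsh J S x := by
  rw [revealedWalsh, revealedWalsh, hJ.apply_flipAt hx, walsh_flipAt_of_notMem hi]

variable [Fintype ι] [DecidableEq ι]

theorem expect_eq_zero_of_unread (hJ : Decides J J) (i : ι) {G : Bits ι → ℝ}
    (hread : ∀ x, i ∈ J x → G x = 0) (hunread : ∀ x, i ∉ J x → G (flipAt i x) = -G x) :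
    𝔼 x, G x = 0 :=
  expect_eq_zero_of_flipAt i fun x => by
    by_cases hi : i ∈ J x
    · rw [hread x hi, hread _ ((hJ.mem_flipAt_iff x).2 hi), neg_zero]
    · exact hunread x hi

theorem expect_mul_revealedWalsh (hJ : Decides J J) (hi : i ∈ S) {G : Bits ι → ℝ}
    (hG : ∀ x, i ∉ J x → G (flipAt i x) = G x) :
    𝔼 x, G x * revealedWalsh J S x = 𝔼 x, G x * walsh S x := by
  rw [← sub_eq_zero, ← expect_sub_distrib]
  refine expect_eq_zero_of_unread hJ i (fun x hx => ?_) fun x hx => ?_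
  · have hS : ¬ Disjoint (S : Set ι) (J x) := Set.not_disjoint_iff.2 ⟨i, hi, hx⟩
    rw [revealedWalsh, if_neg hS, sub_self]
  · rw [hG x hx, revealedWalsh, revealedWalsh, hJ.apply_flipAt hx, walsh_flipAt_of_mem hi]
    split_ifs <;> ring

theorem expect_revealedWalsh_mul_revealedWalsh_eq_zero (hJ : Decides J J) (hST : ¬ S ⊆ T)
    (hTS : ¬ T ⊆ S) : 𝔼 x, revealedWalsh J S x * revealedWalsh J T x = 0 := by
  obtain ⟨i, hiS, hiT⟩ := not_subset.1 hST
  obtain ⟨j, hjT, hjS⟩ := not_subset.1 hTS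
  calc 𝔼 x, revealedWalsh J S x * revealedWalsh J T x
      = 𝔼 x, walsh T x * revealedWalsh J S x := by
        rw [expect_mul_revealedWalsh hJ hjT fun x hx => revealedWalsh_flipAt hJ hjS hx]
        simp only [mul_comm]
    _ = 𝔼 x, walsh T x * walsh S x :=
        expect_mul_revealedWalsh hJ hiS fun x _ => walsh_flipAt_of_notMem hiT x
    _ = 0 := expect_walsh_mul_walsh_eq_zero hTS

theorem expect_revealedWalsh_mul_self (J : Bits ι → Set ι) (S : Finset ι) :
    𝔼 x, revealedWalsh J S x * revealedWalsh J S x =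
      uniformProb fun x => ¬ Disjoint (S : Set ι) (J x) :=
  expect_congr rfl fun x _ => by
    by_cases h : Disjoint (S : Set ι) (J x) <;> simp [revealedWalsh, h, walsh_mul_self]

/-- Both sides compare `f` with `h = ∑ S, walshCoeff f S • revealedWalsh J S`, the sum being over
the sets of size `d`: its inner product with `f` is the level weight, and its summands are
orthogonal. -/
theorem levelWeight_sq_le (hJ : Decides J J) {f : Bits ι → ℝ} (hf : Decides J f) {d : ℕ}
    (hd : d ≠ 0) :
    levelWeight f d ^ 2 ≤ (𝔼 x, f x ^ 2) * ∑ S ∈ powersetCard d univ,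
      walshCoeff f S ^ 2 * uniformProb fun x => ¬ Disjoint (S : Set ι) (J x) := by
  set L := powersetCard d (univ : Finset ι)
  set h : Bits ι → ℝ := fun x => ∑ S ∈ L, walshCoeff f S * revealedWalsh J S x with h_def
  have hfh : 𝔼 x, f x * h x = levelWeight f d := by
    simp only [h_def, mul_sum, mul_left_comm (f _)]
    rw [expect_sum_comm]
    refine sum_congr rfl fun S hS => ?_
    obtain ⟨i, hi⟩ : S.Nonempty := card_ne_zero.1 ((mem_powersetCard.1 hS).2 ▸ hd)
    rw [← mul_expect, expect_mul_revealedWalsh hJ hi fun x hx => hf.apply_flipAt hx, sq, walshCoeff]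
  have horth : ∀ S ∈ L, ∀ T ∈ L, T ≠ S → 𝔼 x, revealedWalsh J S x * revealedWalsh J T x = 0 := by
    intro S hS T hT hne
    have hcard : S.card = T.card := (mem_powersetCard.1 hS).2.trans (mem_powersetCard.1 hT).2.symm
    exact expect_revealedWalsh_mul_revealedWalsh_eq_zero hJ
      (fun hsub => hne (eq_of_subset_of_card_le hsub hcard.ge).symm)
      (fun hsub => hne (eq_of_subset_of_card_le hsub hcard.le))
  have hmul : ∀ S T, 𝔼 x, walshCoeff f S * revealedWalsh J S x *
      (walshCoeff f T * revealedWalsh J T x) =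
        walshCoeff f S * walshCoeff f T * 𝔼 x, revealedWalsh J S x * revealedWalsh J T x :=
    fun S T => by
      rw [mul_expect]
      exact expect_congr rfl fun x _ => mul_mul_mul_comm _ _ _ _
  have hhh : 𝔼 x, h x ^ 2 = ∑ S ∈ L,
      walshCoeff f S ^ 2 * uniformProb fun x => ¬ Disjoint (S : Set ι) (J x) := by
    simp only [h_def, sq (∑ _ ∈ L, _), sum_mul_sum, expect_sum_comm, hmul]
    refine sum_congr rfl fun S hS => ?_
    rw [sum_eq_single_of_mem S hS fun T hT hne => by rw [horth S hS T hT hne, mul_zero],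
      expect_revealedWalsh_mul_self, sq]
  rw [← hfh, ← hhh]
  exact expect_mul_sq_le_sq_mul_sq _ _ _

/-- **Schramm–Steif inequality.** -/
theorem levelWeight_le {R : Type*} [Fintype R] [Nonempty R] {J : R → Bits ι → Set ι}
    (hJ : ∀ r, Decides (J r) (J r)) {f : Bits ι → ℝ} (hf : ∀ r, Decides (J r) f) {δ : ℝ}
    (hδ0 : 0 ≤ δ) (hδ : ∀ i, uniformProb (fun q : R × Bits ι => i ∈ J q.1 q.2) ≤ δ) {d : ℕ}
    (hd : d ≠ 0) : levelWeight f d ≤ d * δ * 𝔼 x, f x ^ 2 := by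
  set E := 𝔼 x, f x ^ 2
  have : 0 ≤ E := expect_nonneg fun _ _ => sq_nonneg _
  have hhit : ∀ S ∈ powersetCard d (univ : Finset ι),
      𝔼 r, uniformProb (fun x => ¬ Disjoint (S : Set ι) (J r x)) ≤ d * δ := by
    intro S hS
    calc 𝔼 r, uniformProb (fun x => ¬ Disjoint (S : Set ι) (J r x))
        = uniformProb fun q : R × Bits ι => ∃ i ∈ S, i ∈ J q.1 q.2 := by
          simp only [uniformProb_prod, Set.not_disjoint_iff, mem_coe]
      _ ≤ ∑ i ∈ S, uniformProb fun q : R × Bits ι => i ∈ J q.1 q.2 :=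
          uniformProb_exists_le_sum S _
      _ ≤ d * δ := by
          rw [← (mem_powersetCard.1 hS).2, ← nsmul_eq_mul]
          exact sum_le_card_nsmul _ _ _ fun i _ => hδ i
  have hsq : levelWeight f d ^ 2 ≤ levelWeight f d * (d * δ * E) :=
    calc levelWeight f d ^ 2
        ≤ 𝔼 r, E * ∑ S ∈ powersetCard d univ,
            walshCoeff f S ^ 2 * uniformProb fun x => ¬ Disjoint (S : Set ι) (J r x) :=
          le_expect univ_nonempty fun r _ => levelWeight_sq_le (hJ r) (hf r) hd
      _ = E * ∑ S ∈ powersetCard d univ,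
            walshCoeff f S ^ 2 * 𝔼 r, uniformProb fun x => ¬ Disjoint (S : Set ι) (J r x) := by
          simp only [← mul_expect, expect_sum_comm]
      _ ≤ E * ∑ S ∈ powersetCard d univ, walshCoeff f S ^ 2 * (d * δ) := by
          gcongr with S hS
          exact hhit S hS
      _ = levelWeight f d * (d * δ * E) := by
          rw [← sum_mul, levelWeight]
          ring
  rcases (levelWeight_nonneg f d).eq_or_lt with h0 | hpos
  · rw [← h0]
    positivity
  · exact le_of_mul_le_mul_left (by rwa [← sq]) hpos

end SchrammSteif

section Noise

instance : MeasurableSingletonClass ℤˣ where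
  measurableSet_singleton a :=
    ⟨{(a : ℤ)}, measurableSet_singleton _, by ext b; simp [Units.ext_iff]⟩

section Coin

variable {ε : ℝ}

theorem isProbabilityMeasure_coin (h0 : 0 ≤ ε) (h1 : ε ≤ 1) : IsProbabilityMeasure (coin ε) := by
  refine ⟨?_⟩
  simp only [coin, Measure.coe_add, Measure.coe_smul, Pi.add_apply, Pi.smul_apply, measure_univ,
    smul_eq_mul, mul_one]
  rw [← ENNReal.ofReal_add (by linarith) h0, sub_add_cancel, ENNReal.ofReal_one]

theorem integral_coin (h0 : 0 ≤ ε) (h1 : ε ≤ 1) (F : ℤˣ → ℝ) :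
    ∫ z, F z ∂(coin ε) = (1 - ε) * F 1 + ε * F (-1) := by
  have hint : ∀ (a : ℤˣ) (c : ℝ), Integrable F (ENNReal.ofReal c • Measure.dirac a) := fun a c =>
    (integrable_dirac (by simp)).smul_measure ENNReal.ofReal_ne_top
  rw [coin, integral_add_measure (hint _ _) (hint _ _), integral_smul_measure,
    integral_smul_measure, integral_dirac, integral_dirac, ENNReal.toReal_ofReal (by linarith),
    ENNReal.toReal_ofReal h0, smul_eq_mul, smul_eq_mul]

theorem coin_half_singleton (a : ℤˣ) : coin (1 / 2) {a} = ENNReal.ofReal (1 / 2) := by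
  rcases Int.units_eq_one_or a with rfl | rfl <;>
    simp only [coin, Measure.coe_add, Measure.coe_smul, Pi.add_apply, Pi.smul_apply,
      measurableSet_singleton, Measure.dirac_apply', smul_eq_mul] <;>
    norm_num [Set.indicator]

instance : IsProbabilityMeasure (coin (1 / 2)) :=
  isProbabilityMeasure_coin (by norm_num) (by norm_num)

end Coin

theorem memLp_bitVal {X : Type*} [MeasurableSpace X] {μ : Measure X} [IsFiniteMeasure μ]
    {b : X → ℤˣ} (hb : Measurable b) : MemLp (fun x => bitVal (b x)) 2 μ :=
  MemLp.of_bound ((Measurable.of_discrete (f := bitVal)).comp hb).aestronglyMeasurable 1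
    (ae_of_all _ fun _ => (abs_bitVal _).le)

variable {ι : Type*} [Fintype ι]

instance : IsProbabilityMeasure (uniformBits ι) := by
  unfold uniformBits
  infer_instance

theorem isProbabilityMeasure_noisyPair {ε : ℝ} (h0 : 0 ≤ ε) (h1 : ε ≤ 1) :
    IsProbabilityMeasure (noisyPair ι ε) := by
  have := isProbabilityMeasure_coin h0 h1
  exact Measure.isProbabilityMeasure_map Measurable.of_discrete.aemeasurable

section Walsh

variable {ε : ℝ}

theorem integral_walsh_coin (h0 : 0 ≤ ε) (h1 : ε ≤ 1) (S : Finset ι) :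
    ∫ z, walsh S z ∂(Measure.pi fun _ : ι => coin ε) = (1 - 2 * ε) ^ S.card := by
  classical
  have := isProbabilityMeasure_coin h0 h1
  have hwalsh : ∀ z : Bits ι, walsh S z = ∏ i, if i ∈ S then bitVal (z i) else 1 := fun z => by
    rw [walsh, prod_ite_mem, univ_inter]
  have hfactor : ∀ i, ∫ a, (if i ∈ S then bitVal a else 1) ∂(coin ε) =
      if i ∈ S then 1 - 2 * ε else 1 := by
    intro i
    split_ifs
    · rw [integral_coin h0 h1, bitVal_neg, bitVal_one]
      ring
    · simp
  simp only [hwalsh]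
  rw [integral_fintype_prod_eq_prod (𝕜 := ℝ) fun i (a : ℤˣ) => if i ∈ S then bitVal a else 1]
  simp only [hfactor]
  rw [prod_ite_mem, univ_inter, prod_const]

variable [DecidableEq ι]

theorem integral_uniformBits (F : Bits ι → ℝ) : ∫ x, F x ∂(uniformBits ι) = 𝔼 x, F x := by
  have hsingleton : ∀ x : Bits ι, (uniformBits ι).real {x} = (Fintype.card (Bits ι) : ℝ)⁻¹ := by
    intro x
    rw [Measure.real, uniformBits, Measure.pi_singleton]
    simp only [coin_half_singleton]
    simp
  rw [integral_fintype Integrable.of_finite]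
  simp only [hsingleton, Fintype.expect_eq_sum_div_card, smul_eq_mul, ← mul_sum]
  exact inv_mul_eq_div _ _

theorem integral_noise (h0 : 0 ≤ ε) (h1 : ε ≤ 1) (f : Bits ι → ℝ) (x : Bits ι) :
    ∫ z, f (fun i => x i * z i) ∂(Measure.pi fun _ : ι => coin ε) =
      ∑ S, (1 - 2 * ε) ^ S.card * (walshCoeff f S * walsh S x) := by
  have := isProbabilityMeasure_coin h0 h1
  simp only [← sum_walshCoeff_mul_walsh f (fun i => x i * _), walsh_mul]
  rw [integral_finsetSum _ fun _ _ => Integrable.of_finite]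
  refine sum_congr rfl fun S _ => ?_
  rw [integral_const_mul, integral_const_mul, integral_walsh_coin h0 h1]
  ring

theorem integral_noisyPair_mul (h0 : 0 ≤ ε) (h1 : ε ≤ 1) (f g : Bits ι → ℝ) :
    ∫ q, f q.1 * g q.2 ∂(noisyPair ι ε) =
      ∑ S, (1 - 2 * ε) ^ S.card * (walshCoeff f S * walshCoeff g S) := by
  have := isProbabilityMeasure_coin h0 h1
  calc ∫ q, f q.1 * g q.2 ∂(noisyPair ι ε)
      = 𝔼 x, f x * ∫ z, g (fun i => x i * z i) ∂(Measure.pi fun _ : ι => coin ε) := by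
        rw [noisyPair, integral_map Measurable.of_discrete.aemeasurable
          Measurable.of_discrete.aestronglyMeasurable, integral_prod _ Integrable.of_finite,
          integral_uniformBits]
        simp only [integral_const_mul]
    _ = ∑ S, 𝔼 x, (1 - 2 * ε) ^ S.card * walshCoeff g S * (f x * walsh S x) := by
        simp only [integral_noise h0 h1, mul_sum]
        rw [expect_sum_comm]
        exact sum_congr rfl fun S _ => expect_congr rfl fun x _ => by ring
    _ = ∑ S, (1 - 2 * ε) ^ S.card * (walshCoeff f S * walshCoeff g S) :=
        sum_congr rfl fun S _ => by
          rw [← mul_expect, walshCoeff, walshCoeff]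
          ring

theorem integral_noisyPair_fst (h0 : 0 ≤ ε) (h1 : ε ≤ 1) (f : Bits ι → ℝ) :
    ∫ q, f q.1 ∂(noisyPair ι ε) = walshCoeff f ∅ := by
  have h := integral_noisyPair_mul h0 h1 f fun _ => 1
  rw [sum_eq_single_of_mem ∅ (mem_univ _) fun S _ hS => by rw [walshCoeff_one hS]; ring] at h
  simpa [walshCoeff, walsh_empty] using h

theorem integral_noisyPair_snd (h0 : 0 ≤ ε) (h1 : ε ≤ 1) (f : Bits ι → ℝ) :
    ∫ q, f q.2 ∂(noisyPair ι ε) = walshCoeff f ∅ := by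
  have h := integral_noisyPair_mul h0 h1 (fun _ => 1) f
  rw [sum_eq_single_of_mem ∅ (mem_univ _) fun S _ hS => by rw [walshCoeff_one hS]; ring] at h
  simpa [walshCoeff, walsh_empty] using h

theorem sum_pow_card_mul_walshCoeff_sq (ρ : ℝ) (f : Bits ι → ℝ) :
    ∑ S : Finset ι, ρ ^ S.card * walshCoeff f S ^ 2 =
      ∑ d ∈ range (Fintype.card ι), ρ ^ (d + 1) * levelWeight f (d + 1) + walshCoeff f ∅ ^ 2 := by
  have hlevel : ∀ d, ∑ S ∈ powersetCard d univ, ρ ^ S.card * walshCoeff f S ^ 2 =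
      ρ ^ d * levelWeight f d := fun d => by
    rw [levelWeight, mul_sum]
    exact sum_congr rfl fun S hS => by rw [(mem_powersetCard.1 hS).2]
  rw [← powerset_univ, sum_powerset, sum_range_succ', card_univ]
  simp only [hlevel]
  simp [levelWeight]

theorem noiseCov_eq_sum_levelWeight (h0 : 0 ≤ ε) (h1 : ε ≤ 1) (f : BoolFun ι) :
    noiseCov f ε = ∑ d ∈ range (Fintype.card ι),
      (1 - 2 * ε) ^ (d + 1) * levelWeight (fun x => bitVal (f x)) (d + 1) := by
  have := isProbabilityMeasure_noisyPair (ι := ι) h0 h1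
  rw [noiseCov, covariance_eq_sub (memLp_bitVal .of_discrete) (memLp_bitVal .of_discrete)]
  simp only [Pi.mul_apply]
  rw [integral_noisyPair_mul h0 h1 (fun x => bitVal (f x)) fun x => bitVal (f x),
    integral_noisyPair_fst h0 h1 fun x => bitVal (f x),
    integral_noisyPair_snd h0 h1 fun x => bitVal (f x)]
  simp only [← sq, sum_pow_card_mul_walshCoeff_sq, add_sub_cancel_right]

/-- The bound is `∑ d, (1 - 2ε)^(d + 1) * (d + 1) * δ ≤ δ * (1 - 2ε) / (2ε)^2`. -/
theorem noiseCov_le_of_levelWeight_le {f : BoolFun ι} (h0 : 0 < ε) (h1 : ε ≤ 1 / 2) {δ : ℝ}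
    (hδ : 0 ≤ δ) (hf : ∀ d ≠ 0, levelWeight (fun x => bitVal (f x)) d ≤ d * δ) :
    noiseCov f ε ≤ δ / (2 * ε) ^ 2 := by
  set ρ := 1 - 2 * ε with hρ
  have hρ0 : 0 ≤ ρ := by linarith
  have hgeom : HasSum (fun d : ℕ => (d : ℝ) * ρ ^ d) (ρ / (1 - ρ) ^ 2) :=
    hasSum_coe_mul_geometric_of_norm_lt_one (by
      rw [Real.norm_of_nonneg hρ0]
      linarith)
  have hpartial : ∑ d ∈ range (Fintype.card ι), ((d + 1 : ℕ) : ℝ) * ρ ^ (d + 1) ≤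
      ρ / (1 - ρ) ^ 2 := by
    refine le_trans ?_ (sum_le_hasSum (range (Fintype.card ι + 1)) (fun d _ => by positivity) hgeom)
    rw [sum_range_succ']
    simp
  calc noiseCov f ε
      = ∑ d ∈ range (Fintype.card ι),
          ρ ^ (d + 1) * levelWeight (fun x => bitVal (f x)) (d + 1) :=
        noiseCov_eq_sum_levelWeight h0.le (by linarith) f
    _ ≤ ∑ d ∈ range (Fintype.card ι), ρ ^ (d + 1) * ((d + 1 : ℕ) * δ) := by
        gcongr with d
        exact hf (d + 1) d.succ_ne_zero
    _ = (∑ d ∈ range (Fintype.card ι), ((d + 1 : ℕ) : ℝ) * ρ ^ (d + 1)) * δ := by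
        rw [sum_mul]
        exact sum_congr rfl fun d _ => by ring
    _ ≤ 1 / (2 * ε) ^ 2 * δ := by
        rw [show 2 * ε = 1 - ρ by rw [hρ]; ring]
        gcongr
        refine hpartial.trans ?_
        gcongr
        linarith
    _ = δ / (2 * ε) ^ 2 := by ring

end Walsh

theorem noiseCov_nonneg {ε : ℝ} (h0 : 0 ≤ ε) (h1 : ε ≤ 1 / 2) (f : BoolFun ι) :
    0 ≤ noiseCov f ε := by
  classical
  rw [noiseCov_eq_sum_levelWeight h0 (by linarith)]
  exact sum_nonneg fun d _ =>
    mul_nonneg (pow_nonneg (by linarith) _) (levelWeight_nonneg _ _)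

end Noise

section Rows

theorem apply_mul_of_odd {ι : Type*} {f : BoolFun ι} (hf : Function.Odd f) (s : ℤˣ)
    (x : Bits ι) : f (fun j => s * x j) = s * f x := by
  rcases Int.units_eq_one_or s with rfl | rfl
  · simp only [one_mul]
  · simp only [neg_one_mul]
    exact hf x

/-- The stride-2 convolution of a sequence of bits with a gate. -/
def convRow (g : BoolFun (Fin 3)) (x : Bits ℕ) : Bits ℕ := fun i => g fun j => x (2 * i + j)

/-- Row `k` of the network with gates `g 0, g 1, …` above the bottom row `x`. Rows are taken to be
infinite, which spares index bounds: a node never depends on nodes to its left. -/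
def rows (g : ℕ → BoolFun (Fin 3)) : ℕ → Bits ℕ → Bits ℕ
  | 0, x => x
  | k + 1, x => convRow (g k) (rows g k x)

theorem rows_add (g : ℕ → BoolFun (Fin 3)) (k m : ℕ) (x : Bits ℕ) :
    rows g (k + m) x = rows (fun i => g (k + i)) m (rows g k x) := by
  induction m with
  | zero => rfl
  | succ m ih => rw [← add_assoc, rows, ih, rows]

/-- The nodes in the bottom row on which node `i` of row `k` depends. -/
def cone (k i : ℕ) : Set ℕ := {j | 2 ^ k * i ≤ j ∧ j + 1 < 2 ^ k * (i + 2)}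

theorem cone_child_subset (k i : ℕ) (e : Fin 3) : cone k (2 * i + e) ⊆ cone (k + 1) i :=
  fun j ⟨hleft, hright⟩ =>
    ⟨(by rw [pow_succ, mul_assoc]; gcongr; omega : 2 ^ (k + 1) * i ≤ _).trans hleft,
      hright.trans_le (by rw [pow_succ, mul_assoc]; gcongr; omega)⟩

theorem rows_rel {g : ℕ → BoolFun (Fin 3)} {r : ℤˣ → ℤˣ → Prop}
    (hg : ∀ k x x', (∀ j, r (x j) (x' j)) → r (g k x) (g k x')) {x x' : Bits ℕ} {k i : ℕ}
    (h : ∀ j ∈ cone k i, r (x j) (x' j)) : r (rows g k x i) (rows g k x' i) := by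
  induction k generalizing i with
  | zero => exact h i (by simp [cone])
  | succ k ih => exact hg k _ _ fun e => ih fun j hj => h j (cone_child_subset k i e hj)

theorem dependsOn_rows (g : ℕ → BoolFun (Fin 3)) (k i : ℕ) :
    DependsOn (fun x => rows g k x i) (cone k i) := fun _ _ h =>
  rows_rel (fun k _ _ hx => congrArg (g k) (funext hx)) h

theorem rows_mul {g : ℕ → BoolFun (Fin 3)} (hg : ∀ k, Function.Odd (g k)) (s : ℤˣ)
    {x x' : Bits ℕ} {k i : ℕ} (h : ∀ j ∈ cone k i, x' j = s * x j) :
    rows g k x' i = s * rows g k x i :=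
  rows_rel (r := fun a a' => a = s * a')
    (fun k x x' hx => by rw [funext hx, apply_mul_of_odd (hg k)]) h

end Rows

section SignedMajority

/-- A gate is a signed majority, i.e. the 3-majority or its negative, if it is up to the sign `g 1`
equal to any two of its inputs that agree. -/
def IsSignedMajority (g : BoolFun (Fin 3)) : Prop :=
  ∀ ⦃x : Bits (Fin 3)⦄ ⦃i j : Fin 3⦄, i ≠ j → x i = x j → g x = g 1 * x i

variable {g : BoolFun (Fin 3)} {x : Bits ℕ} {τ : ℤˣ}

theorem IsSignedMajority.convRow_eq (hg : IsSignedMajority g) {i : ℕ} {e e' : Fin 3} (hne : e ≠ e')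
    (h : x (2 * i + e) = τ) (h' : x (2 * i + e') = τ) : convRow g x i = g 1 * τ := by
  rw [← h]
  exact hg (x := fun e => x (2 * i + e)) hne (h.trans h'.symm)

theorem IsSignedMajority.convRow_eq_of_even (hg : IsSignedMajority g) {a n o : ℕ}
    (h : ∀ i < n + 1, i ≠ o → x (2 * a + 2 * i) = τ) {i : ℕ} (hi : i < n) (ho : i ≠ o)
    (ho' : i + 1 ≠ o) : convRow g x (a + i) = g 1 * τ :=
  hg.convRow_eq (e := 0) (e' := 2) (by decide)
    (by rw [← h i (by omega) ho]; congr 1; simp; ring)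
    (by rw [← h (i + 1) (by omega) ho']; congr 1; simp; ring)

theorem IsSignedMajority.convRow_eq_of_seven (hg : IsSignedMajority g) {a o : ℕ}
    (h : ∀ i < 7, i ≠ o → i + 1 ≠ o → x (2 * a + i) = τ) {j : ℕ} (hj : j < 3)
    (ho : 2 * j + 1 ≠ o) (ho' : 2 * j + 2 ≠ o) : convRow g x (a + j) = g 1 * τ := by
  have hcentre : x (2 * (a + j) + (1 : Fin 3)) = τ := by
    rw [← h (2 * j + 1) (by omega) (by omega) (by omega)]; congr 1; simp; ring
  rcases lt_or_ge (2 * j) o with hlt | hge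
  · refine hg.convRow_eq (e := 0) (by decide) ?_ hcentre
    rw [← h (2 * j) (by omega) (by omega) (by omega)]; congr 1; simp; ring
  · refine hg.convRow_eq (e' := 2) (by decide) hcentre ?_
    rw [← h (2 * j + 2) (by omega) (by omega) (by omega)]; congr 1; simp; ring

theorem IsSignedMajority.convRow_eq_of_three (hg : IsSignedMajority g) {a o : ℕ}
    (h : ∀ j < 3, 2 * j + 1 ≠ o → 2 * j + 2 ≠ o → x (2 * a + j) = τ) :
    convRow g x a = g 1 * τ := by
  have hchild : ∀ e : Fin 3, 2 * (e : ℕ) + 1 ≠ o → 2 * (e : ℕ) + 2 ≠ o → x (2 * a + e) = τ :=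
    fun e => h e e.2
  by_cases h0 : o = 1 ∨ o = 2
  · exact hg.convRow_eq (e := 1) (e' := 2) (by decide) (hchild 1 (by simp; omega) (by simp; omega))
      (hchild 2 (by simp; omega) (by simp; omega))
  by_cases h1 : o = 3 ∨ o = 4
  · exact hg.convRow_eq (e := 0) (e' := 2) (by decide) (hchild 0 (by simp; omega) (by simp; omega))
      (hchild 2 (by simp; omega) (by simp; omega))
  · exact hg.convRow_eq (e := 0) (e' := 1) (by decide) (hchild 0 (by simp; omega) (by simp; omega))
      (hchild 1 (by simp; omega) (by simp; omega))

/-- The exceptional node spoils two adjacent nodes of row 1. Only one of these is the middle child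
of a node of row 2, so at most one node of row 2 is spoiled. -/
theorem rows_three_eq_of_even {g : ℕ → BoolFun (Fin 3)} (hg : ∀ k < 3, IsSignedMajority (g k))
    {I : ℕ} (o : ℕ) (h : ∀ i < 8, i ≠ o → x (8 * I + 2 * i) = τ) :
    rows g 3 x I = g 2 1 * (g 1 1 * (g 0 1 * τ)) := by
  have hrow1 : ∀ i < 7, i ≠ o → i + 1 ≠ o → rows g 1 x (2 * (2 * I) + i) = g 0 1 * τ :=
    fun i hi ho ho' => (hg 0 (by norm_num)).convRow_eq_of_even (n := 7)
      (fun i hi ho => (congrArg x (by ring)).trans (h i hi ho)) hi ho ho'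
  have hrow2 : ∀ j < 3, 2 * j + 1 ≠ o → 2 * j + 2 ≠ o →
      rows g 2 x (2 * I + j) = g 1 1 * (g 0 1 * τ) :=
    fun j hj ho ho' => (hg 1 (by norm_num)).convRow_eq_of_seven hrow1 hj ho ho'
  exact (hg 2 (by norm_num)).convRow_eq_of_three hrow2

end SignedMajority

section Alignment

/-- Cut the inputs of a row-`k` network into blocks of `2 ^ k`. Node `j` of row `k` sees block `t`
if it depends on inputs of that block, i.e. `t` is `j` or `j + 1`. -/
def Sees (j t : ℕ) : Prop := j = t ∨ j + 1 = t

/-- The situation in which a window of four majority layers hides block `t`: the even nodes in the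
sixteen blocks around `t` all equal `τ`, and if the middle child of a node of row 4 sees block `t`,
then the two outer children of that node agree. -/
def IsAligned (g : ℕ → BoolFun (Fin 3)) (y : Bits ℕ) (t : ℕ) : Prop :=
  (∃ τ, ∀ i < 8, y (16 * (t / 16) + 2 * i) = τ) ∧
    ∀ I, Sees (2 * I + 1) (t / 8) → rows g 3 y (2 * I) = rows g 3 y (2 * I + 2)

variable {g : ℕ → BoolFun (Fin 3)} {y y' : Bits ℕ} {t : ℕ}

theorem rows_three_eq_of_not_sees {I : ℕ} (hI : ¬ Sees I (t / 8))
    (h : ∀ j ∈ cone 3 I, ¬ Sees j t → y' j = y j) : rows g 3 y' I = rows g 3 y I :=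
  dependsOn_rows g 3 I fun j hj => h j hj fun hjt => hI <| by
    simp only [cone, Set.mem_ofPred_eq, Sees] at hj hjt ⊢
    omega

theorem rows_three_eq_of_isAligned (hg : ∀ k < 3, IsSignedMajority (g k)) (hal : IsAligned g y t)
    (h : ∀ j ∈ cone 3 (2 * (t / 16)), ¬ Sees j t → y' j = y j) :
    rows g 3 y' (2 * (t / 16)) = rows g 3 y (2 * (t / 16)) := by
  obtain ⟨τ, hτ⟩ := hal.1
  have heven : ∀ i < 8, y (8 * (2 * (t / 16)) + 2 * i) = τ := fun i hi => by
    rw [← hτ i hi]; congr 1; ring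
  rw [rows_three_eq_of_even hg 8 fun i hi _ => heven i hi,
    rows_three_eq_of_even hg (t % 16 / 2) fun i hi ho => ?_]
  rw [← heven i hi]
  exact h _ (by simp only [cone, Set.mem_ofPred_eq]; omega) (by unfold Sees; omega)

theorem rows_four_eq_of_isAligned (hg : ∀ k < 4, IsSignedMajority (g k)) (hal : IsAligned g y t)
    {I : ℕ} (h : ∀ j ∈ cone 4 I, ¬ Sees j t → y' j = y j) : rows g 4 y' I = rows g 4 y I := by
  have hchild : ∀ e : Fin 3, ∀ j ∈ cone 3 (2 * I + e), ¬ Sees j t → y' j = y j :=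
    fun e j hj => h j (cone_child_subset 3 I e hj)
  have hregular : ∀ e : Fin 3, ¬ Sees (2 * I + e) (t / 8) ∨ 2 * I + e = 2 * (t / 16) →
      rows g 3 y' (2 * I + e) = rows g 3 y (2 * I + e) := by
    rintro e (he | he)
    · exact rows_three_eq_of_not_sees he (hchild e)
    · have := hchild e
      rw [he] at this ⊢
      exact rows_three_eq_of_isAligned (fun k hk => hg k (by omega)) hal this
  have h0 := hregular 0 (by simp [Sees]; omega)
  have h2 := hregular 2 (by simp [Sees]; omega)
  by_cases hmid : Sees (2 * I + 1) (t / 8)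
  · have hout := hal.2 I hmid
    exact ((hg 3 (by norm_num)).convRow_eq (e := 0) (e' := 2) (by decide) h0
      (h2.trans hout.symm)).trans ((hg 3 (by norm_num)).convRow_eq (e := 0) (e' := 2) (by decide)
        rfl hout.symm).symm
  · have h1 := hregular 1 (Or.inl hmid)
    refine congrArg (g 3) (funext fun e => ?_)
    fin_cases e
    exacts [h0, h1, h2]

end Alignment

section BlockFlip

/-- The extension by `1` of a finite bit string, the bottom row of an infinite array of rows. -/
def extendBits {N : ℕ} (x : Bits (Fin N)) : Bits ℕ := fun j => if h : j < N then x ⟨j, h⟩ else 1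

/-- Multiplication by the signs `s` on block `J` of size `2 ^ (k + 4)`, where each sign is used for
two consecutive blocks of size `2 ^ k`. An even node of row `k` sees one such pair of blocks, so
that the even nodes within block `J` can be flipped independently. -/
def blockFlip (N k J : ℕ) (s : Fin 8 → ℤˣ) : Bits (Fin N) ≃ Bits (Fin N) :=
  Equiv.mulLeft fun j =>
    if (j : ℕ) / 2 ^ (k + 4) = J then s (Fin.ofNat 8 (j / 2 ^ (k + 1))) else 1

theorem sees_of_mem_cone {k i j : ℕ} (h : j ∈ cone k i) : Sees i (j / 2 ^ k) := by
  have hleft : i ≤ j / 2 ^ k :=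
    (Nat.le_div_iff_mul_le (by positivity)).2 (by rw [mul_comm]; exact h.1)
  have hright : j / 2 ^ k < i + 2 :=
    Nat.div_lt_of_lt_mul (j.lt_succ_self.trans h.2)
  unfold Sees
  omega

variable {g : ℕ → BoolFun (Fin 3)} {N k J : ℕ}

theorem rows_blockFlip_of_forall_ne (s : Fin 8 → ℤˣ) (x : Bits (Fin N)) {m i : ℕ}
    (h : ∀ j ∈ cone m i, j / 2 ^ (k + 4) ≠ J) :
    rows g m (extendBits (blockFlip N k J s x)) i = rows g m (extendBits x) i :=
  dependsOn_rows g m i fun j hj => by simp [extendBits, blockFlip, h j hj]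

theorem rows_blockFlip_even (hg : ∀ k, Function.Odd (g k)) (hN : 2 ^ (k + 4) * (J + 1) ≤ N + 1)
    (s : Fin 8 → ℤˣ) (x : Bits (Fin N)) (i : Fin 8) :
    rows g k (extendBits (blockFlip N k J s x)) (16 * J + 2 * i) =
      s i * rows g k (extendBits x) (16 * J + 2 * i) := by
  refine rows_mul hg _ fun j hj => ?_
  have hpair : j / 2 ^ (k + 1) = 8 * J + i := by
    rcases sees_of_mem_cone hj with h | h <;>
      rw [pow_succ, ← Nat.div_div_eq_div_mul] <;> omega
  have hblock : j / 2 ^ (k + 4) = J := by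
    rw [show k + 4 = k + 1 + 3 by rfl, pow_add, ← Nat.div_div_eq_div_mul, hpair]
    omega
  have hlt : j < N := by
    have hend : 2 ^ k * (16 * J + 2 * i + 2) ≤ 2 ^ (k + 4) * (J + 1) := by
      rw [pow_add, mul_assoc]
      gcongr
      omega
    have := hj.2
    omega
  have hsign : Fin.ofNat 8 (8 * J + i) = i := by
    ext
    simp only [Fin.val_ofNat]
    omega
  simp only [extendBits, hlt, dif_pos, blockFlip, Equiv.coe_mulLeft, Pi.mul_apply, hblock, if_true,
    hpair, hsign]

theorem exists_blockFlip_even_eq (hg : ∀ k, Function.Odd (g k))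
    (hN : 2 ^ (k + 4) * (J + 1) ≤ N + 1) (x : Bits (Fin N)) (τ : ℤˣ) :
    ∃ s, ∀ i < 8, rows g k (extendBits (blockFlip N k J s x)) (16 * J + 2 * i) = τ :=
  ⟨fun i => τ * rows g k (extendBits x) (16 * J + 2 * i), fun i hi => by
    rw [rows_blockFlip_even hg hN _ x ⟨i, hi⟩, mul_assoc, Int.units_mul_self, mul_one]⟩

theorem exists_blockFlip_isAligned (hg : ∀ k, Function.Odd (g k))
    (hmaj : ∀ i < 4, IsSignedMajority (g (k + i))) {t : ℕ}
    (hN : 2 ^ (k + 4) * (t / 16 + 1) ≤ N + 1) (x : Bits (Fin N)) :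
    ∃ s, IsAligned (fun i => g (k + i)) (rows g k (extendBits (blockFlip N k (t / 16) s x))) t := by
  set J := t / 16 with hJ
  set c := g (k + 2) 1 * (g (k + 1) 1 * g (k + 0) 1) with hc
  set neighbour := if t / 8 % 2 = 1 then 2 * J + 2 else 2 * J - 2 with hnb
  obtain ⟨s, hs⟩ := exists_blockFlip_even_eq hg hN x (c * rows g (k + 3) (extendBits x) neighbour)
  refine ⟨s, ⟨_, hs⟩, fun I hI => ?_⟩
  have hmid := rows_three_eq_of_even (g := fun i => g (k + i)) (fun i hi => hmaj i (by omega))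
    (I := 2 * J) 8 fun i hi _ => (congrArg _ (by ring)).trans (hs i hi)
  have hfixed : rows g (k + 3) (extendBits (blockFlip N k J s x)) neighbour =
      rows g (k + 3) (extendBits x) neighbour := by
    refine rows_blockFlip_of_forall_ne s x fun j hj => ?_
    have := sees_of_mem_cone hj
    rw [pow_succ, ← Nat.div_div_eq_div_mul]
    simp only [Sees] at this hI
    split_ifs at hnb <;> omega
  have hagree : rows (fun i => g (k + i)) 3 (rows g k (extendBits (blockFlip N k J s x))) (2 * J) =
      rows (fun i => g (k + i)) 3 (rows g k (extendBits (blockFlip N k J s x))) neighbour := by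
    rw [hmid, ← rows_add, hfixed, ← mul_assoc, ← mul_assoc, ← mul_assoc, mul_assoc (g (k + 2) 1),
      hc, Int.units_mul_self, one_mul]
  rcases hI with hI | hI
  · rw [show neighbour = 2 * I + 2 by rw [hnb, if_pos (by omega)]; omega,
      show 2 * J = 2 * I by omega] at hagree
    exact hagree
  · rw [show neighbour = 2 * I by rw [hnb, if_neg (by omega)]; omega,
      show 2 * J = 2 * I + 2 by omega] at hagree
    exact hagree.symm

end BlockFlip

section Revealment

/-- A set of nodes touches block `t` if one of its nodes sees that block. -/
def Touches (s : Set ℕ) (t : ℕ) : Prop := ∃ j ∈ s, Sees j t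

/-- The query rule for node `J` four rows up that reads the nodes seeing no block congruent to `c`
modulo `32` first, and all others only if needed. A cone of height four sees `32` consecutive
blocks, so exactly one of them is spared at first. -/
def windowQuery (g : ℕ → BoolFun (Fin 3)) (c : Fin 32) (y : Bits ℕ) (J : ℕ) : Set ℕ :=
  lazyQuery (fun y => rows g 4 y J) (cone 4 J \ {j | ∃ t, Sees j t ∧ t % 32 = c}) (cone 4 J) y

variable {g : ℕ → BoolFun (Fin 3)} {c : Fin 32} {t : ℕ} {y : Bits ℕ} {Q : Bits ℕ → Set ℕ}

theorem windowQuery_subset (J : ℕ) : windowQuery g c y J ⊆ cone 4 J :=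
  lazyQuery_subset Set.sdiff_subset y

theorem decides_windowQuery (J : ℕ) :
    Decides (fun y => windowQuery g c y J) fun y => rows g 4 y J :=
  decides_lazyQuery (dependsOn_rows g 4 J)

theorem decides_windowQuery_self (J : ℕ) :
    Decides (fun y => windowQuery g c y J) fun y => windowQuery g c y J :=
  decides_lazyQuery_self Set.sdiff_subset

theorem sees_of_touches_windowQuery {J : ℕ} (h : Touches (windowQuery g c y J) t) :
    Sees J (t / 16) := by
  obtain ⟨j, hj, hjt⟩ := h
  have := windowQuery_subset J hj
  simp only [cone, Set.mem_ofPred_eq, Sees] at this hjt ⊢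
  omega

theorem touches_of_touches_refineRule
    (h : Touches (refineRule (rows g 4) (windowQuery g c) Q y) t) :
    Touches (Q (rows g 4 y)) (t / 16) := by
  obtain ⟨j, hj, hjt⟩ := h
  obtain ⟨J, hJ, hjJ⟩ := Set.mem_iUnion₂.1 hj
  exact ⟨J, hJ, sees_of_touches_windowQuery ⟨j, hjJ, hjt⟩⟩

theorem not_touches_windowQuery (hg : ∀ k < 4, IsSignedMajority (g k)) (hal : IsAligned g y t)
    (hc : t % 32 = c) (J : ℕ) : ¬ Touches (windowQuery g c y J) t := fun htouch => by
  have hJ := sees_of_touches_windowQuery htouch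
  have hspare : ∀ j ∈ cone 4 J, ¬ Sees j t → ∀ t', Sees j t' → t' % 32 ≠ c := by
    simp only [cone, Set.mem_ofPred_eq, Sees] at hJ ⊢
    omega
  have hdecided : ∀ y', Set.EqOn y y' (cone 4 J \ {j | ∃ t, Sees j t ∧ t % 32 = c}) →
      rows g 4 y J = rows g 4 y' J := fun y' h =>
    (rows_four_eq_of_isAligned hg hal fun j hj hjt =>
      (h ⟨hj, fun ⟨t', ht', htc⟩ => hspare j hj hjt t' ht' htc⟩).symm).symm
  obtain ⟨j, hj, hjt⟩ := htouch
  rw [windowQuery, lazyQuery, if_pos hdecided] at hj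
  exact hj.2 ⟨t, hjt, hc⟩

theorem not_touches_refineRule (hg : ∀ k < 4, IsSignedMajority (g k)) (hal : IsAligned g y t)
    (hc : t % 32 = c) : ¬ Touches (refineRule (rows g 4) (windowQuery g c) Q y) t := by
  rintro ⟨j, hj, hjt⟩
  obtain ⟨J, -, hjJ⟩ := Set.mem_iUnion₂.1 hj
  exact not_touches_windowQuery hg hal hc J ⟨j, hjJ, hjt⟩

theorem touches_of_touches_blockFlip {N k J : ℕ} (hQ : Decides Q Q) (s : Fin 8 → ℤˣ)
    (x : Bits (Fin N)) (h : Touches (Q (rows g (k + 4) (extendBits (blockFlip N k J s x)))) J) :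
    Touches (Q (rows g (k + 4) (extendBits x))) J := by
  by_contra hx
  have hread : Set.EqOn (rows g (k + 4) (extendBits x))
      (rows g (k + 4) (extendBits (blockFlip N k J s x))) (Q (rows g (k + 4) (extendBits x))) :=
    fun I hI => (rows_blockFlip_of_forall_ne s x fun j hj hjJ =>
      hx ⟨I, hI, by simpa only [hjJ] using sees_of_mem_cone hj⟩).symm
  exact hx (hQ hread ▸ h)

/-- The output node `m` rows above row `k` of a network with `N` inputs can be decided by randomized
query rules for row `k` that, on uniform inputs, touch each block with probability at most `δ`. -/
def HasRevealment (g : ℕ → BoolFun (Fin 3)) (N k m : ℕ) (δ : ℝ) : Prop :=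
  ∃ (R : Type) (_ : Fintype R) (_ : Nonempty R) (Q : R → Bits ℕ → Set ℕ),
    (∀ r, Decides (Q r) (Q r)) ∧
    (∀ r, Decides (Q r) fun y => rows (fun i => g (k + i)) m y 0) ∧
    ∀ t < 2 ^ (m + 1), uniformProb (fun q : R × Bits (Fin N) =>
      Touches (Q q.1 (rows g k (extendBits q.2))) t) ≤ δ

theorem hasRevealment_one (g : ℕ → BoolFun (Fin 3)) (N k m : ℕ) : HasRevealment g N k m 1 :=
  ⟨Unit, inferInstance, inferInstance, fun _ _ => Set.univ, fun _ _ _ _ => rfl,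
    fun _ x y h => by rw [(Set.eqOn_univ x y).1 h], fun _ _ => uniformProb_le_one _⟩

open Classical in
/-- The factor by which the revealment drops across the window of the four layers above row `k`. To
spare a given block, one out of the `32` choices in `windowQuery` and one out of the `2 ^ 8` sign
patterns in `blockFlip` suffice. -/
def windowFactor (g : ℕ → BoolFun (Fin 3)) (k : ℕ) : ℝ :=
  if ∀ i < 4, IsSignedMajority (g (k + i)) then 1 - 1 / 8192 else 1

theorem windowFactor_nonneg (g : ℕ → BoolFun (Fin 3)) (k : ℕ) : 0 ≤ windowFactor g k := by
  unfold windowFactor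
  split_ifs <;> norm_num

theorem uniformProb_touches_refineRule_le (hg : ∀ k, Function.Odd (g k)) {N k : ℕ}
    (hN : 2 ^ (k + 4) * (t / 16 + 1) ≤ N + 1) {R : Type*} [Fintype R] {Q : R → Bits ℕ → Set ℕ}
    (hQ : ∀ r, Decides (Q r) (Q r)) :
    uniformProb (fun q : (Fin 32 × R) × Bits (Fin N) => Touches (refineRule
      (rows (fun i => g (k + i)) 4) (windowQuery (fun i => g (k + i)) q.1.1) (Q q.1.2)
        (rows g k (extendBits q.2))) t) ≤
      windowFactor g k * uniformProb fun q : R × Bits (Fin N) =>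
        Touches (Q q.1 (rows g (k + 4) (extendBits q.2))) (t / 16) := by
  have hforget : uniformProb (fun q : (Fin 32 × R) × Bits (Fin N) =>
      Touches (Q q.1.2 (rows g (k + 4) (extendBits q.2))) (t / 16)) =
      uniformProb fun q : R × Bits (Fin N) =>
        Touches (Q q.1 (rows g (k + 4) (extendBits q.2))) (t / 16) :=
    (uniformProb_comp_equiv (Equiv.prodAssoc _ _ _) fun q =>
      Touches (Q q.2.1 (rows g (k + 4) (extendBits q.2.2))) (t / 16)).trans (uniformProb_snd
        fun q : R × Bits (Fin N) => Touches (Q q.1 (rows g (k + 4) (extendBits q.2))) (t / 16))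
  rw [← hforget]
  unfold windowFactor
  split_ifs with hmaj
  · have hcard : Fintype.card (Fin 32 × (Fin 8 → ℤˣ)) = 8192 := by simp
    have hcontract := uniformProb_le_of_exists_equiv (S := Fin 32 × (Fin 8 → ℤˣ)) (fun s =>
      ((Equiv.addRight s.1).prodCongr (Equiv.refl R)).prodCongr (blockFlip N k (t / 16) s.2))
      (fun q => touches_of_touches_refineRule (g := fun i => g (k + i)) (c := q.1.1)
        (Q := Q q.1.2) (y := rows g k (extendBits q.2)) (t := t))
      (fun s q => touches_of_touches_blockFlip (hQ q.1.2) s.2 q.2)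
      fun q => by
        obtain ⟨s, hs⟩ := exists_blockFlip_isAligned hg hmaj hN q.2
        exact ⟨(Fin.ofNat 32 t - q.1.1, s), not_touches_refineRule hmaj hs (by simp)⟩
    rw [hcard, Nat.cast_ofNat] at hcontract
    exact hcontract
  · rw [one_mul]
    exact uniformProb_mono fun q => touches_of_touches_refineRule

theorem HasRevealment.window (hg : ∀ k, Function.Odd (g k)) {N k m : ℕ} {δ : ℝ}
    (hN : 2 ^ (k + 4) * 2 ^ (m + 1) ≤ N + 1) (h : HasRevealment g N (k + 4) m δ) :
    HasRevealment g N k (4 + m) (windowFactor g k * δ) := by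
  obtain ⟨R, _, _, Q, hQ, hF, hδ⟩ := h
  refine ⟨Fin 32 × R, inferInstance, inferInstance, fun q => refineRule
    (rows (fun i => g (k + i)) 4) (windowQuery (fun i => g (k + i)) q.1) (Q q.2),
    fun q => (hQ q.2).refine_self decides_windowQuery decides_windowQuery_self, fun q => ?_,
    fun t ht => ?_⟩
  · simpa only [rows_add, add_assoc] using (hF q.2).refine decides_windowQuery
  · have htm : t / 16 < 2 ^ (m + 1) := Nat.div_lt_of_lt_mul (ht.trans_eq (by ring))
    exact (uniformProb_touches_refineRule_le hg (le_trans (by gcongr; omega) hN) hQ).trans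
      (mul_le_mul_of_nonneg_left (hδ _ htm) (windowFactor_nonneg g k))

theorem HasRevealment.windows (hg : ∀ k, Function.Odd (g k)) {N m s : ℕ} {δ : ℝ}
    (hN : 2 ^ (4 * s + m + 1) ≤ N + 1) (h : HasRevealment g N (4 * s) m δ) :
    HasRevealment g N 0 (4 * s + m) ((∏ t ∈ range s, windowFactor g (4 * t)) * δ) := by
  induction s generalizing m δ with
  | zero => simpa using h
  | succ s ih =>
    have hwindow : HasRevealment g N (4 * s) (4 + m) (windowFactor g (4 * s) * δ) :=
      HasRevealment.window hg (by rw [← pow_add]; convert hN using 2; ring) h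
    rw [prod_range_succ, mul_assoc, mul_add, mul_one, add_assoc]
    exact ih (by convert hN using 2; ring) hwindow

theorem noiseCov_le_of_hasRevealment {N m : ℕ} (hN : N < 2 ^ (m + 1)) {δ ε : ℝ} (hδ : 0 ≤ δ)
    (h0 : 0 < ε) (h1 : ε ≤ 1 / 2) (h : HasRevealment g N 0 m δ) :
    noiseCov (fun x : Bits (Fin N) => rows g m (extendBits x) 0) ε ≤ δ / (2 * ε) ^ 2 := by
  obtain ⟨R, _, _, Q, hQ, hF, hprob⟩ := h
  have hext : ∀ r ⦃x y : Bits (Fin N)⦄, Set.EqOn x y (Fin.val ⁻¹' Q r (extendBits x)) →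
      Set.EqOn (extendBits x) (extendBits y) (Q r (extendBits x)) := fun r x y hxy i hi => by
    unfold extendBits
    split_ifs with hiN
    exacts [hxy (x := ⟨i, hiN⟩) hi, rfl]
  refine noiseCov_le_of_levelWeight_le h0 h1 hδ fun d hd => ?_
  refine (levelWeight_le (J := fun r x => Fin.val ⁻¹' Q r (extendBits x))
    (fun r x y hxy => congrArg _ (hQ r (hext r hxy)))
    (fun r x y hxy => congrArg bitVal ?_) hδ (fun i => ?_) hd).trans_eq ?_
  · simpa only [zero_add] using hF r (hext r hxy)
  · exact (uniformProb_mono fun q hq => ⟨i, hq, Or.inl rfl⟩).trans (hprob i (by omega))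
  · simp [sq, bitVal_mul_self]

theorem noiseCov_rows_le (hg : ∀ k, Function.Odd (g k)) (n : ℕ) {ε : ℝ} (h0 : 0 < ε)
    (h1 : ε ≤ 1 / 2) :
    noiseCov (fun x : Bits (Layer n) => rows g n (extendBits x) 0) ε ≤
      (∏ t ∈ range (n / 4), windowFactor g (4 * t)) / (2 * ε) ^ 2 := by
  have hreveal := (hasRevealment_one g (2 ^ (n + 1) - 1) (4 * (n / 4)) (n % 4)).windows hg
    (by rw [Nat.div_add_mod]; omega)
  rw [Nat.div_add_mod, mul_one] at hreveal
  exact noiseCov_le_of_hasRevealment (by have := Nat.one_le_two_pow (n := n + 1); omega)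
    (prod_nonneg fun t _ => windowFactor_nonneg g _) h0 h1 hreveal

end Revealment

section Network

theorem sgn_neg {z : ℝ} (hz : z ≠ 0) : sgn (-z) = -sgn z := by
  unfold sgn
  rcases hz.lt_or_gt with h | h
  · simp [h.le, not_le.2 h]
  · simp [h.le, not_le.2 h]

theorem preact_neg (θ : Fin 3 → ℝ) (x : Bits (Fin 3)) : preact θ (-x) = -preact θ x := by
  simp [preact, bitVal_neg]

theorem NoTies.odd_weightedMaj {θ : Fin 3 → ℝ} (hθ : NoTies θ) : Function.Odd (weightedMaj θ) :=
  fun x => by rw [weightedMaj, preact_neg, sgn_neg (hθ x), weightedMaj]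

theorem maj3_eq {x : Bits (Fin 3)} {i j : Fin 3} (hij : i ≠ j) (h : x i = x j) : maj3 x = x i := by
  rcases Int.units_eq_one_or (x 0) with h0 | h0 <;>
    rcases Int.units_eq_one_or (x 1) with h1 | h1 <;>
    rcases Int.units_eq_one_or (x 2) with h2 | h2 <;> fin_cases i <;> fin_cases j <;>
    simp_all [maj3, weightedMaj, preact, Fin.sum_univ_three, sgn, bitVal] <;> norm_num

theorem ExpressesMajority.isSignedMajority {θ : Fin 3 → ℝ} (hθ : ExpressesMajority θ) :
    IsSignedMajority (weightedMaj θ) := by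
  intro x i j hij h
  have hone : maj3 1 = 1 := maj3_eq (x := 1) (i := 0) (j := 1) (by decide) rfl
  rcases hθ with hθ | hθ <;> simp [hθ, maj3_eq hij h, hone]

/-- The gates of a network as an infinite sequence, completed by dictators above the output. -/
def networkGates {n : ℕ} (θ : Fin n → Fin 3 → ℝ) (k : ℕ) : BoolFun (Fin 3) :=
  if h : k < n then weightedMaj (θ ⟨k, h⟩) else fun x => x 0

variable {n : ℕ} {θ : Fin n → Fin 3 → ℝ}

theorem odd_networkGates (hθ : ∀ t, NoTies (θ t)) (k : ℕ) : Function.Odd (networkGates θ k) := by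
  unfold networkGates
  split_ifs
  · exact (hθ _).odd_weightedMaj
  · exact fun _ => rfl

theorem networkGates_one_add (θ : Fin (n + 1) → Fin 3 → ℝ) :
    (fun k => networkGates θ (1 + k)) = networkGates (Fin.tail θ) := by
  funext k
  simp only [networkGates, add_comm 1, Nat.add_lt_add_iff_right]
  rfl

theorem network_eq_rows (θ : Fin n → Fin 3 → ℝ) (ω : Bits (Layer n)) :
    network n θ ω = rows (networkGates θ) n (extendBits ω) 0 := by
  induction n with
  | zero => simp [network, rows, extendBits]
  | succ n ih =>
    have hrows : rows (networkGates θ) (n + 1) (extendBits ω) =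
        rows (networkGates (Fin.tail θ)) n (rows (networkGates θ) 1 (extendBits ω)) := by
      rw [← networkGates_one_add, ← rows_add, Nat.add_comm 1]
    rw [hrows]
    refine (ih _ _).trans (dependsOn_rows _ n 0 fun j hj => ?_)
    have hlt : j + 1 < 2 ^ (n + 1) := by simpa [cone, pow_succ] using hj
    have hj : j < 2 ^ (n + 1) - 1 := by omega
    have hchild : ∀ e : Fin 3, 2 * j + e < 2 ^ (n + 1 + 1) - 1 := fun e => by
      rw [pow_succ]; omega
    simp [extendBits, hj, rows, convRow, networkGates, hchild, convLayer, child]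

theorem network_neg (hθ : ∀ t, NoTies (θ t)) (ω : Bits (Layer n)) :
    network n θ (-ω) = -network n θ ω := by
  induction n with
  | zero => rfl
  | succ n ih =>
    have hlayer : convLayer (m := n) (θ 0) (-ω) = -convLayer (θ 0) ω :=
      funext fun i => (hθ 0).odd_weightedMaj _
    exact (congrArg _ hlayer).trans (ih (fun t => hθ _) _)

end Network

section RandomFilters

theorem measurable_weightedMaj : Measurable weightedMaj := by
  have hsgn : Measurable sgn := Measurable.ite measurableSet_Ici measurable_const measurable_const
  refine measurable_pi_iff.2 fun x => hsgn.comp ?_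
  unfold preact
  fun_prop

theorem measurableSet_expressesMajority : MeasurableSet {θ | ExpressesMajority θ} :=
  measurable_weightedMaj
    (.of_discrete : MeasurableSet {g : BoolFun (Fin 3) | (∀ x, g x = maj3 x) ∨ ∀ x, g x = -maj3 x})

theorem network_congr {n : ℕ} {θ θ' : Fin n → Fin 3 → ℝ}
    (h : ∀ t, weightedMaj (θ t) = weightedMaj (θ' t)) : network n θ = network n θ' := by
  have hgates : networkGates θ = networkGates θ' := by
    funext k
    simp only [networkGates, h]
  funext ω
  rw [network_eq_rows, network_eq_rows, hgates]

theorem measurable_network (n : ℕ) : Measurable (network n) := by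
  have hgates : Measurable fun (θ : Fin n → Fin 3 → ℝ) t => weightedMaj (θ t) :=
    measurable_pi_iff.2 fun t => measurable_weightedMaj.comp (measurable_pi_apply t)
  obtain ⟨F, hF⟩ := (Function.factorsThrough_iff (f := fun (θ : Fin n → Fin 3 → ℝ) t =>
    weightedMaj (θ t)) (network n)).1 fun θ θ' h => network_congr (congrFun h)
  rw [hF]
  exact Measurable.of_discrete.comp hgates

end RandomFilters

section Independence

variable {Ω E τ κ : Type*} [MeasurableSpace Ω] [MeasurableSpace E] {P : Measure Ω}

theorem iIndepSet_iInter_preimage [Finite κ] {X : τ × κ → Ω → E} (hX : ∀ q, Measurable (X q))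
    (hind : iIndepFun X P) {G : Set E} (hG : MeasurableSet G) :
    iIndepSet (fun t => ⋂ i, X (t, i) ⁻¹' G) P := by
  have := Fintype.ofFinite κ
  have hcomap : ∀ q, MeasurableSet[MeasurableSpace.comap (X q) ‹_›] (X q ⁻¹' G) := fun q =>
    ⟨G, hG, rfl⟩
  rw [iIndepSet_iff_meas_biInter fun t => MeasurableSet.iInter fun i => hX (t, i) hG]
  intro s
  have hinter : ⋂ t ∈ s, ⋂ i, X (t, i) ⁻¹' G = ⋂ q ∈ s ×ˢ (univ : Finset κ), X q ⁻¹' G := by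
    ext w
    simp only [Set.mem_iInter, mem_product, mem_univ, and_true, Prod.forall]
    exact forall_congr' fun t => forall_comm
  have hblock : ∀ t, P (⋂ i, X (t, i) ⁻¹' G) = ∏ i, P (X (t, i) ⁻¹' G) := fun t =>
    (hind.precomp (Prod.mk_right_injective t)).meas_iInter fun i => hcomap (t, i)
  rw [hinter, hind.meas_biInter fun q _ => hcomap q, prod_product]
  simp only [hblock]

theorem measureReal_iInter_preimage_ge [Fintype κ] {X : κ → Ω → E} (hind : iIndepFun X P)
    {G : Set E} (hG : MeasurableSet G) {p : ℝ} (hp : 0 ≤ p) (hge : ∀ i, p ≤ P.real (X i ⁻¹' G)) :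
    p ^ Fintype.card κ ≤ P.real (⋂ i, X i ⁻¹' G) := by
  rw [Measure.real, hind.meas_iInter fun i => ⟨G, hG, rfl⟩, ENNReal.toReal_prod, ← card_univ,
    ← prod_const]
  exact prod_le_prod (fun _ _ => hp) fun i _ => hge i

theorem integral_prod_one_sub_indicator [Fintype τ] {A : τ → Set Ω}
    (hA : ∀ t, MeasurableSet (A t)) (hind : iIndepSet A P) (c : ℝ) :
    ∫ w, ∏ t, (1 - c * (A t).indicator 1 w) ∂P = ∏ t, (1 - c * P.real (A t)) := by
  have := hind.isProbabilityMeasure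
  have hindicator : ∀ t, Measurable ((A t).indicator (1 : Ω → ℝ)) := fun t =>
    measurable_one.indicator (hA t)
  have hint : ∀ t, Integrable ((A t).indicator (1 : Ω → ℝ)) P := fun t =>
    (integrable_const 1).indicator (hA t)
  have hprod := (hind.iIndepFun_indicator (β := ℝ)).integral_fun_prod_comp (𝕜 := ℝ)
    (fun t => (hindicator t).aemeasurable) (f := fun _ y => 1 - c * y)
    fun t => by fun_prop
  refine hprod.trans (prod_congr rfl fun t _ => ?_)
  change ∫ w, (1 - c * (A t).indicator 1 w) ∂P = 1 - c * P.real (A t)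
  rw [integral_sub (integrable_const 1) ((hint t).const_mul c), integral_const_mul,
    integral_indicator_one (hA t)]
  simp

end Independence

section NetworkLaw

variable {n : ℕ}

/-- Layer `i` of the `t`-th window of four consecutive layers. -/
def windowLayer (q : Fin (n / 4) × Fin 4) : Fin n := ⟨4 * q.1 + q.2, by omega⟩

theorem windowLayer_injective : Function.Injective (windowLayer (n := n)) := by
  rintro ⟨s, i⟩ ⟨t, j⟩ h
  have hval : 4 * (s : ℕ) + i = 4 * t + j := congrArg Fin.val h
  ext <;> dsimp only <;> omega

theorem windowFactor_networkGates (θ : Fin n → Fin 3 → ℝ) (t : Fin (n / 4))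
    (h : ∀ i, ExpressesMajority (θ (windowLayer (t, i)))) :
    windowFactor (networkGates θ) (4 * t) = 1 - 1 / 8192 := by
  refine if_pos fun i hi => ?_
  have hlt : 4 * (t : ℕ) + i < n := by omega
  rw [networkGates, dif_pos hlt]
  exact (h ⟨i, hi⟩).isSignedMajority

theorem noiseCov_network_le {θ : Fin n → Fin 3 → ℝ} (hθ : ∀ t, NoTies (θ t)) {ε : ℝ} (h0 : 0 < ε)
    (h1 : ε ≤ 1 / 2) :
    noiseCov (network n θ) ε ≤
      (∏ t : Fin (n / 4), windowFactor (networkGates θ) (4 * t)) / (2 * ε) ^ 2 := by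
  rw [funext (network_eq_rows θ), ← prod_range fun t => windowFactor (networkGates θ) (4 * t)]
  exact noiseCov_rows_le (odd_networkGates hθ) n h0 h1

variable {Ω : Type*}

/-- The event that all filters in the `t`-th window express a majority. -/
def majorityWindow (θ : Fin n → Ω → Fin 3 → ℝ) (t : Fin (n / 4)) : Set Ω :=
  ⋂ i, θ (windowLayer (t, i)) ⁻¹' {η | ExpressesMajority η}

theorem windowFactor_le_one_sub_indicator (θ : Fin n → Ω → Fin 3 → ℝ) (t : Fin (n / 4)) (w : Ω) :
    windowFactor (networkGates fun s => θ s w) (4 * t) ≤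
      1 - 1 / 8192 * (majorityWindow θ t).indicator 1 w := by
  by_cases hw : w ∈ majorityWindow θ t
  · rw [Set.indicator_of_mem hw, Pi.one_apply, mul_one]
    exact (windowFactor_networkGates (fun s => θ s w) t (Set.mem_iInter.1 hw)).le
  · rw [Set.indicator_of_notMem hw, mul_zero, sub_zero, windowFactor]
    split_ifs <;> norm_num

variable [MeasurableSpace Ω] {P : Measure Ω} {θ : Fin n → Ω → Fin 3 → ℝ}

theorem measurableSet_majorityWindow (hmeas : ∀ t, Measurable (θ t)) (t : Fin (n / 4)) :
    MeasurableSet (majorityWindow θ t) :=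
  MeasurableSet.iInter fun _ => hmeas _ measurableSet_expressesMajority

theorem measurable_network_comp (hmeas : ∀ t, Measurable (θ t)) :
    Measurable fun w => network n fun t => θ t w :=
  (measurable_network n).comp (measurable_pi_iff.2 hmeas)

theorem isProbabilityMeasure_networkLaw [IsProbabilityMeasure P] (hmeas : ∀ t, Measurable (θ t)) :
    IsProbabilityMeasure (networkLaw P n θ) :=
  Measure.isProbabilityMeasure_map (measurable_network_comp hmeas).aemeasurable

theorem ae_networkLaw_odd (hmeas : ∀ t, Measurable (θ t)) (hties : ∀ t, ∀ᵐ w ∂P, NoTies (θ t w)) :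
    ∀ᵐ f ∂(networkLaw P n θ), Function.Odd f := by
  rw [networkLaw, ae_map_iff (measurable_network_comp hmeas).aemeasurable .of_discrete]
  filter_upwards [ae_all_iff.2 hties] with w hw using network_neg hw

theorem integral_noiseCov_networkLaw_le_integral [IsFiniteMeasure P]
    (hmeas : ∀ t, Measurable (θ t)) (hties : ∀ t, ∀ᵐ w ∂P, NoTies (θ t w)) {ε : ℝ} (h0 : 0 < ε)
    (h1 : ε ≤ 1 / 2) :
    ∫ f, noiseCov f ε ∂(networkLaw P n θ) ≤
      (∫ w, ∏ t, (1 - 1 / 8192 * (majorityWindow θ t).indicator 1 w) ∂P) / (2 * ε) ^ 2 := by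
  have hindicator : ∀ t, Measurable ((majorityWindow θ t).indicator (1 : Ω → ℝ)) := fun t =>
    measurable_one.indicator (measurableSet_majorityWindow hmeas t)
  have hmem : ∀ w t, 1 - 1 / 8192 * (majorityWindow θ t).indicator 1 w ∈ Set.Icc (0 : ℝ) 1 := by
    intro w t
    by_cases hw : w ∈ majorityWindow θ t <;> norm_num [hw]
  have hint : Integrable
      (fun w => ∏ t, (1 - 1 / 8192 * (majorityWindow θ t).indicator (1 : Ω → ℝ) w)) P := by
    refine Integrable.of_bound (C := 1) (by fun_prop) (ae_of_all _ fun w => ?_)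
    rw [Real.norm_of_nonneg (prod_nonneg fun t _ => (hmem w t).1)]
    exact prod_le_one (fun t _ => (hmem w t).1) fun t _ => (hmem w t).2
  rw [networkLaw, integral_map (measurable_network_comp hmeas).aemeasurable
    Measurable.of_discrete.aestronglyMeasurable, ← integral_div]
  refine integral_mono_of_nonneg (ae_of_all _ fun w => noiseCov_nonneg h0.le h1 _)
    (hint.div_const _) ?_
  filter_upwards [ae_all_iff.2 hties] with w hw
  refine (noiseCov_network_le hw h0 h1).trans ?_
  gcongr with t
  · exact fun t _ => windowFactor_nonneg _ _
  · exact windowFactor_le_one_sub_indicator θ t w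

theorem integral_noiseCov_networkLaw_le (hmeas : ∀ t, Measurable (θ t)) (hind : iIndepFun θ P)
    (hties : ∀ t, ∀ᵐ w ∂P, NoTies (θ t w)) {p : ℝ} (hp : 0 ≤ p)
    (hmaj : ∀ t, p ≤ P.real {w | ExpressesMajority (θ t w)}) {ε : ℝ} (h0 : 0 < ε)
    (h1 : ε ≤ 1 / 2) :
    ∫ f, noiseCov f ε ∂(networkLaw P n θ) ≤
      (1 - 1 / 8192 * p ^ 4) ^ (n / 4) / (2 * ε) ^ 2 := by
  have := hind.isProbabilityMeasure
  have hwindows : iIndepFun (fun q => θ (windowLayer q)) P := hind.precomp windowLayer_injective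
  have hprob : ∀ t, p ^ 4 ≤ P.real (majorityWindow θ t) := fun t =>
    measureReal_iInter_preimage_ge (X := fun i => θ (windowLayer (t, i)))
      (hwindows.precomp (g := fun i => (t, i)) (Prod.mk_right_injective t))
      measurableSet_expressesMajority hp fun i => hmaj _
  calc ∫ f, noiseCov f ε ∂(networkLaw P n θ)
      ≤ (∫ w, ∏ t, (1 - 1 / 8192 * (majorityWindow θ t).indicator 1 w) ∂P) / (2 * ε) ^ 2 :=
        integral_noiseCov_networkLaw_le_integral hmeas hties h0 h1
    _ = (∏ t, (1 - 1 / 8192 * P.real (majorityWindow θ t))) / (2 * ε) ^ 2 := by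
        rw [integral_prod_one_sub_indicator (measurableSet_majorityWindow hmeas)
          (iIndepSet_iInter_preimage (fun q => hmeas _) hwindows measurableSet_expressesMajority)]
    _ ≤ (∏ _t : Fin (n / 4), (1 - 1 / 8192 * p ^ 4)) / (2 * ε) ^ 2 := by
        gcongr with t
        · intro t _
          linarith [measureReal_le_one (μ := P) (s := majorityWindow θ t)]
        · exact hprob t
    _ = (1 - 1 / 8192 * p ^ 4) ^ (n / 4) / (2 * ε) ^ 2 := by
        rw [prod_const, card_univ, Fintype.card_fin]

end NetworkLaw

section NoiseSensitivity

section Annealed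

variable {ι : Type*} [Fintype ι] {ε : ℝ}

theorem integral_noisyPair_eq_zero_of_odd (h0 : 0 ≤ ε) (h1 : ε ≤ 1) {f : BoolFun ι}
    (hf : Function.Odd f) : ∫ q, bitVal (f q.1) ∂(noisyPair ι ε) = 0 := by
  classical
  have hodd : 𝔼 x, bitVal (f x) = 𝔼 x, -bitVal (f x) :=
    Fintype.expect_equiv (Equiv.neg _) _ _ fun x => by simp [hf x, bitVal_neg]
  rw [expect_neg_distrib, self_eq_neg] at hodd
  rw [integral_noisyPair_fst h0 h1 fun x => bitVal (f x)]
  simpa [walshCoeff, walsh_empty] using hodd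

theorem annealedNoiseCov_eq_integral (h0 : 0 ≤ ε) (h1 : ε ≤ 1) (π : Measure (BoolFun ι))
    [IsProbabilityMeasure π] (hπ : ∀ᵐ f ∂π, Function.Odd f) :
    annealedNoiseCov π ε = ∫ f, noiseCov f ε ∂π := by
  have := isProbabilityMeasure_noisyPair (ι := ι) h0 h1
  have hmean : ∫ q, bitVal (q.1 q.2.1) ∂(π.prod (noisyPair ι ε)) = 0 := by
    rw [integral_prod _ Integrable.of_finite]
    refine integral_eq_zero_of_ae ?_
    filter_upwards [hπ] with f hf using integral_noisyPair_eq_zero_of_odd h0 h1 hf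
  rw [annealedNoiseCov, covariance_eq_sub (memLp_bitVal .of_discrete) (memLp_bitVal .of_discrete),
    hmean, zero_mul, sub_zero, integral_prod _ Integrable.of_finite]
  refine integral_congr_ae ?_
  filter_upwards [hπ] with f hf
  rw [noiseCov, covariance_eq_sub (memLp_bitVal .of_discrete) (memLp_bitVal .of_discrete),
    integral_noisyPair_eq_zero_of_odd h0 h1 hf, zero_mul, sub_zero]
  rfl

end Annealed

variable {ι : ℕ → Type*} [∀ n, Fintype (ι n)] {π : ∀ n, Measure (BoolFun (ι n))}
  [∀ n, IsProbabilityMeasure (π n)]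

theorem quenchedNoiseSensitive_of_tendsto
    (h : ∀ ε : ℝ, 0 < ε → ε ≤ 1 / 2 → Tendsto (fun n => ∫ f, noiseCov f ε ∂(π n)) atTop (𝓝 0)) :
    QuenchedNoiseSensitive π := by
  intro ε h0 h1 δ hδ
  obtain ⟨N, hN⟩ := eventually_atTop.1 ((h ε h0 h1).eventually_le_const (mul_pos hδ hδ))
  refine ⟨N, fun n hn => ?_⟩
  have hmarkov : δ * (π n).real {f | δ ≤ noiseCov f ε} ≤ δ * δ :=
    (mul_meas_ge_le_integral_of_nonneg (ae_of_all _ fun f => noiseCov_nonneg h0.le h1 f)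
      Integrable.of_finite δ).trans (hN n hn)
  have hcompl : (π n).real {f | noiseCov f ε ≤ δ}ᶜ ≤ (π n).real {f | δ ≤ noiseCov f ε} :=
    measureReal_mono fun f hf => (not_le.1 (Set.notMem_ofPred_iff.1 hf)).le
  rw [probReal_compl_eq_one_sub .of_discrete] at hcompl
  linarith [le_of_mul_le_mul_left hmarkov hδ]

theorem annealedNoiseSensitive_of_tendsto (hodd : ∀ n, ∀ᵐ f ∂(π n), Function.Odd f)
    (h : ∀ ε : ℝ, 0 < ε → ε ≤ 1 / 2 → Tendsto (fun n => ∫ f, noiseCov f ε ∂(π n)) atTop (𝓝 0)) :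
    AnnealedNoiseSensitive π := by
  intro ε h0 h1
  refine (h ε h0 h1).congr fun n => ?_
  exact (annealedNoiseCov_eq_integral h0.le (by linarith) (π n) (hodd n)).symm

end NoiseSensitivity

end

end NoiseNet

theorem mainTheorem10 {Ω : ℕ → Type*} [∀ n, MeasurableSpace (Ω n)]
    (P : ∀ n, Measure (Ω n)) [∀ n, IsProbabilityMeasure (P n)]
    (θ : ∀ n, Fin n → Ω n → Fin 3 → ℝ)
    (hmeas : ∀ n t, Measurable (θ n t))
    (hindep : ∀ n, iIndepFun (θ n) (P n))
    (hties : ∀ n t, ∀ᵐ w ∂(P n), NoiseNet.NoTies (θ n t w))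
    (p : ℝ) (hp : 0 < p)
    (hmaj : ∀ n t, p ≤ (P n).real {w | NoiseNet.ExpressesMajority (θ n t w)}) :
    NoiseNet.QuenchedNoiseSensitive (fun n => NoiseNet.networkLaw (P n) n (θ n)) ∧
      NoiseNet.AnnealedNoiseSensitive (fun n => NoiseNet.networkLaw (P n) n (θ n)) := by
  have hp1 : p ≤ 1 := (hmaj 1 0).trans measureReal_le_one
  have hprob : ∀ n, IsProbabilityMeasure (NoiseNet.networkLaw (P n) n (θ n)) := fun n =>
    NoiseNet.isProbabilityMeasure_networkLaw (hmeas n)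
  have hdecay : ∀ ε : ℝ,
      Tendsto (fun n : ℕ => (1 - 1 / 8192 * p ^ 4) ^ (n / 4) / (2 * ε) ^ 2) atTop (𝓝 0) := by
    intro ε
    have hgeom := tendsto_pow_atTop_nhds_zero_of_lt_one (r := 1 - 1 / 8192 * p ^ 4)
      (by linarith [pow_le_one₀ (n := 4) hp.le hp1]) (by linarith [pow_pos hp 4])
    simpa using (hgeom.comp (Nat.tendsto_div_const_atTop four_ne_zero)).div_const ((2 * ε) ^ 2)
  have hlim : ∀ ε : ℝ, 0 < ε → ε ≤ 1 / 2 →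
      Tendsto (fun n => ∫ f, NoiseNet.noiseCov f ε ∂(NoiseNet.networkLaw (P n) n (θ n)))
        atTop (𝓝 0) := fun ε h0 h1 =>
    squeeze_zero (fun n => integral_nonneg (NoiseNet.noiseCov_nonneg h0.le h1))
      (fun n => NoiseNet.integral_noiseCov_networkLaw_le (hmeas n) (hindep n) (hties n) hp.le
        (hmaj n) h0 h1) (hdecay ε)
  exact ⟨NoiseNet.quenchedNoiseSensitive_of_tendsto hlim,
    NoiseNet.annealedNoiseSensitive_of_tendsto
      (fun n => NoiseNet.ae_networkLaw_odd (hmeas n) (hties n)) hlim⟩
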